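/- Let $S$ be a finite set (of colors), let $\Bbbk$ be a complete local commutative ring (complete and separated in the topology of its maximal ideal), and let $\delta\in\Bbbk$. Let $S\mathcal{TL}$ be the $S$-colored Temperley-Lieb $2$-category over $\Bbbk$, regarded as a $\Bbbk$-linear category by forgetting horizontal composition. Its objects are the non-empty sequences $x=s_1s_2\cdots s_m$ of elements of $S$ with $s_i\neq s_{i+1}$ for all $i$; we write $\ell(x)=m$. Its morphisms are generated, under $\Bbbk$-linear combinations, vertical composition and horizontal composition with identities, by the caps $brb\to b$ and the cups $b\to brb$ (for $b\ne r$ in $S$), subject to the interchange law, the isotopy (zigzag) relations, and the relation that a circle equals $-\delta$, for all colorings of the regions. Let $\mathbf{Kar}(S\mathcal{TL})$ be the Karoubi envelope of the additive closure of $S\mathcal{TL}$. For a sequence $x$, let $I_{<x}\subset \mathrm{End}(x)$ be the $\Bbbk$-span of the colored crossingless matchings from $x$ to $x$ other than the identity. For every sequence $x$ the identity of $x$ has a decomposition $\mathbb{1}=\sum_i e_i$ into finitely many orthogonal indecomposable idempotents of $\mathrm{End}(x)$ in which some member $e_0$ satisfies $e_0\equiv \mathbb{1}$ modulo $I_{<x}$.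 For each $x$ choose such a decomposition together with such an $e_0$, and let $V_x\in\mathbf{Kar}(S\mathcal{TL})$ be the image of $e_0$. Then the objects $V_x$, over all sequences $x$, form a complete list of pairwise non-isomorphic indecomposable objects of $\mathbf{Kar}(S\mathcal{TL})$: each $V_x$ is indecomposable, $V_x\not\cong V_y$ for $x\neq y$, and every indecomposable object is isomorphic to some $V_x$. Moreover, for every $x$ there are multiplicities $m_y\in\mathbb{Z}_{\ge0}$, only finitely many of them non-zero, with $$x\;\cong\; V_x\oplus\bigoplus_{\ell(y)<\ell(x)}V_y^{\oplus m_y}.$$ Finally, up to isomorphism, the object $V_x$ does not depend on the chosen decomposition. -/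

import Mathlib

open CategoryTheory CategoryTheory.Limits CategoryTheory.Idempotents

universe u v

/-- A 1-morphism of the `S`-colored Temperley-Lieb 2-category: a non-empty sequence of colors in
which adjacent colors are distinct. Its source is its last color, its target its first color. -/
structure ColorSeq (S : Type u) where
  colors : List S
  ne_nil : colors ≠ []
  chain : colors.IsChain (fun s t => s ≠ t)

/-- The length of a 1-morphism is the number of colors (so identity 1-morphisms have length 1). -/
def ColorSeq.length {S : Type u} (x : ColorSeq S) : ℕ := x.colors.length

/-- The two kinds of generating 2-morphisms: caps `b r b ⟶ b` and cups `b ⟶ b r b`. -/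
inductive TLKind where
  | cap
  | cup

/-- The source of the cap or cup with outer color `b` and inner color `r`. -/
def TLKind.src {S : Type u} (κ : TLKind) (b r : S) : List S :=
  match κ with
  | .cap => [b, r, b]
  | .cup => [b]

/-- The target of the cap or cup with outer color `b` and inner color `r`. -/
def TLKind.tgt {S : Type u} (κ : TLKind) (b r : S) : List S :=
  match κ with
  | .cap => [b]
  | .cup => [b, r, b]

/-- A cap or a cup, whiskered by identity 2-morphisms on its left and on its right. Here
`left` and `right` are the colors strictly before and after those of the cap or cup; the condition
`outer ≠ inner` follows from the validity of the two color sequences. -/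
structure TLGen {S : Type u} (x y : ColorSeq S) where
  kind : TLKind
  outer : S
  inner : S
  left : List S
  right : List S
  src_eq : x.colors = left ++ kind.src outer inner ++ right
  tgt_eq : y.colors = left ++ kind.tgt outer inner ++ right

instance colorSeqQuiver (S : Type u) : Quiver (ColorSeq S) where
  Hom x y := TLGen x y

/-- A diagram: a vertical composite of whiskered cups and caps (read from bottom to top). -/
abbrev TLDiagram {S : Type u} (x y : ColorSeq S) := Quiver.Path x y

/-- The diagram consisting of one whiskered cup or cap. -/
abbrev TLGen.one {S : Type u} {x y : ColorSeq S} (g : TLGen x y) : TLDiagram x y :=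
  Quiver.Hom.toPath (V := ColorSeq S) g

/-- The diagram with `g` below `h`. -/
abbrev TLGen.two {S : Type u} {x y z : ColorSeq S} (g : TLGen x y) (h : TLGen y z) :
    TLDiagram x z :=
  g.one.comp h.one

/-- The defining relations, in arbitrary whiskering: `TLRel δ p c q` is the relation `p = c • q`.
* `interchange` is the interchange law of a 2-category for a generator `g`
  and a generator `h` to its right (whose boundary 1-morphisms may share one color).
* `zigzag_left`, `zigzag_right` are the two isotopy relations straightening a strand of `b r`.
* `circle` evaluates a circle with interior color `r` in a region of color `b` to `-δ`. -/
inductive TLRel {S : Type u} {k : Type v} [CommRing k] (δ : k) :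
    ∀ {x y : ColorSeq S}, TLDiagram x y → k → TLDiagram x y → Prop
  | interchange {x y y' z : ColorSeq S} (g : TLGen x y) (h : TLGen y z)
      (h' : TLGen x y') (g' : TLGen y' z)
      (g_kind : g'.kind = g.kind) (g_outer : g'.outer = g.outer) (g_inner : g'.inner = g.inner)
      (h_kind : h'.kind = h.kind) (h_outer : h'.outer = h.outer) (h_inner : h'.inner = h.inner)
      (g_left : g'.left = g.left) (h_right : h'.right = h.right)
      (disjoint : g.left.length + (g.kind.src g.outer g.inner).length ≤ h'.left.length + 1) :
      TLRel δ (g.two h) 1 (h'.two g')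
  | zigzag_left {x y : ColorSeq S} (u w : List S) (b r : S) (g : TLGen x y) (h : TLGen y x)
      (g_eq : g.kind = .cup ∧ g.outer = b ∧ g.inner = r ∧ g.left = u ∧ g.right = r :: w)
      (h_eq : h.kind = .cap ∧ h.outer = r ∧ h.inner = b ∧ h.left = u ++ [b] ∧ h.right = w) :
      TLRel δ (g.two h) 1 Quiver.Path.nil
  | zigzag_right {x y : ColorSeq S} (u w : List S) (b r : S) (g : TLGen x y) (h : TLGen y x)
      (g_eq : g.kind = .cup ∧ g.outer = r ∧ g.inner = b ∧ g.left = u ++ [b] ∧ g.right = w)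
      (h_eq : h.kind = .cap ∧ h.outer = b ∧ h.inner = r ∧ h.left = u ∧ h.right = r :: w) :
      TLRel δ (g.two h) 1 Quiver.Path.nil
  | circle {x y : ColorSeq S} (u w : List S) (b r : S) (g : TLGen x y) (h : TLGen y x)
      (g_eq : g.kind = .cup ∧ g.outer = b ∧ g.inner = r ∧ g.left = u ∧ g.right = w)
      (h_eq : h.kind = .cap ∧ h.outer = b ∧ h.inner = r ∧ h.left = u ∧ h.right = w) :
      TLRel δ (g.two h) (-δ) Quiver.Path.nil

/-- The free `k`-linear category on diagrams. -/
abbrev FreeTL (S : Type u) (k : Type v) [CommRing k] := Free k (Paths (ColorSeq S))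

/-- A diagram as a morphism of the free `k`-linear category on diagrams. -/
noncomputable def FreeTL.ofDiagram {S : Type u} (k : Type v) [CommRing k] {x y : ColorSeq S}
    (p : TLDiagram x y) :
    (Free.of k ((Paths.of (ColorSeq S)).obj x) : FreeTL S k) ⟶
      Free.of k ((Paths.of (ColorSeq S)).obj y) :=
  (Free.embedding k (Paths (ColorSeq S))).map p

/-- The two-sided ideal of the free `k`-linear category generated by the defining relations. -/
noncomputable def FreeTL.relIdeal {S : Type u} {k : Type v} [CommRing k] (δ : k) (X Y : FreeTL S k) :
    Submodule k (X ⟶ Y) :=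
  Submodule.span k {f | ∃ (x y : ColorSeq S) (p q : TLDiagram x y) (c : k)
    (a : X ⟶ Free.of k ((Paths.of (ColorSeq S)).obj x))
    (b : Free.of k ((Paths.of (ColorSeq S)).obj y) ⟶ Y),
    TLRel δ p c q ∧ f = a ≫ (FreeTL.ofDiagram k p - c • FreeTL.ofDiagram k q) ≫ b}

theorem FreeTL.comp_mem_relIdeal {S : Type u} {k : Type v} [CommRing k] (δ : k)
    {X Y Z : FreeTL S k} (f : X ⟶ Y) {g : Y ⟶ Z} (hg : g ∈ FreeTL.relIdeal δ Y Z) :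
    f ≫ g ∈ FreeTL.relIdeal δ X Z := by
  induction hg using Submodule.span_induction with
  | mem g hg =>
    obtain ⟨x, y, p, q, c, a, b, h, rfl⟩ := hg
    exact Submodule.subset_span ⟨x, y, p, q, c, f ≫ a, b, h, (Category.assoc _ _ _).symm⟩
  | zero => rw [comp_zero]; exact Submodule.zero_mem _
  | add g₁ g₂ _ _ h₁ h₂ => rw [Preadditive.comp_add]; exact Submodule.add_mem _ h₁ h₂
  | smul c g _ h => rw [Linear.comp_smul]; exact Submodule.smul_mem _ _ h

theorem FreeTL.mem_relIdeal_comp {S : Type u} {k : Type v} [CommRing k] (δ : k)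
    {X Y Z : FreeTL S k} {f : X ⟶ Y} (g : Y ⟶ Z) (hf : f ∈ FreeTL.relIdeal δ X Y) :
    f ≫ g ∈ FreeTL.relIdeal δ X Z := by
  induction hf using Submodule.span_induction with
  | mem f hf =>
    obtain ⟨x, y, p, q, c, a, b, h, rfl⟩ := hf
    exact Submodule.subset_span ⟨x, y, p, q, c, a, b ≫ g, h, by simp only [Category.assoc]⟩
  | zero => rw [zero_comp]; exact Submodule.zero_mem _
  | add g₁ g₂ _ _ h₁ h₂ => rw [Preadditive.add_comp]; exact Submodule.add_mem _ h₁ h₂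
  | smul c g _ h => rw [Linear.smul_comp]; exact Submodule.smul_mem _ _ h

/-- Equality of morphisms modulo the defining relations. -/
def FreeTL.rel {S : Type u} {k : Type v} [CommRing k] (δ : k) : HomRel (FreeTL S k) :=
  fun X Y f g => f - g ∈ FreeTL.relIdeal δ X Y

instance FreeTL.rel_congruence {S : Type u} {k : Type v} [CommRing k] (δ : k) :
    Congruence (FreeTL.rel (S := S) δ) where
  equivalence :=
    { refl := fun f => by
        change f - f ∈ _
        rw [sub_self]; exact Submodule.zero_mem _
      symm := fun {f g} h => by
        change g - f ∈ _
        rw [← neg_sub]; exact Submodule.neg_mem _ h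
      trans := fun {f g e} h₁ h₂ => by
        change f - e ∈ _
        rw [← sub_add_sub_cancel f g e]; exact Submodule.add_mem _ h₁ h₂ }
  comp_left f g g' h := by
    change f ≫ g - f ≫ g' ∈ _
    rw [← Preadditive.comp_sub]; exact FreeTL.comp_mem_relIdeal δ f h
  comp_right g h := by
    rename_i f f'
    change f ≫ g - f' ≫ g ∈ _
    rw [← Preadditive.sub_comp]; exact FreeTL.mem_relIdeal_comp δ g h

theorem FreeTL.rel_add {S : Type u} {k : Type v} [CommRing k] (δ : k) ⦃X Y : FreeTL S k⦄
    (f₁ f₂ g₁ g₂ : X ⟶ Y) (hf : FreeTL.rel δ f₁ f₂) (hg : FreeTL.rel δ g₁ g₂) :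
    FreeTL.rel δ (f₁ + g₁) (f₂ + g₂) := by
  change _ - _ ∈ _
  rw [add_sub_add_comm]; exact Submodule.add_mem _ hf hg

theorem FreeTL.rel_smul {S : Type u} {k : Type v} [CommRing k] (δ : k) (a : k)
    ⦃X Y : FreeTL S k⦄ (f₁ f₂ : X ⟶ Y) (hf : FreeTL.rel δ f₁ f₂) :
    FreeTL.rel δ (a • f₁) (a • f₂) := by
  change _ - _ ∈ _
  rw [← smul_sub]; exact Submodule.smul_mem _ _ hf

/-- The `S`-colored Temperley-Lieb 2-category over `k`, where the `ℤ[δ]`-algebra structure of `k`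
is given by the image of `δ` in `k`, viewed as a `k`-linear category by forgetting horizontal
concatenation: its objects are the 1-morphisms, its morphisms are the 2-morphisms. -/
abbrev STL (S : Type u) {k : Type v} [CommRing k] (δ : k) :=
  CategoryTheory.Quotient (FreeTL.rel (S := S) δ)

noncomputable instance STL.preadditive (S : Type u) {k : Type v} [CommRing k] (δ : k) :
    Preadditive (STL S δ) :=
  Quotient.preadditive _ (FreeTL.rel_add δ)

instance STL.functor_additive (S : Type u) {k : Type v} [CommRing k] (δ : k) :
    (Quotient.functor (FreeTL.rel (S := S) δ)).Additive :=
  Quotient.functor_additive _ (FreeTL.rel_add δ)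

noncomputable instance STL.linear (S : Type u) {k : Type v} [CommRing k] (δ : k) :
    Linear k (STL S δ) :=
  Quotient.linear k _ (FreeTL.rel_smul δ)

/-- The sequence `x` as an object of `STL S δ`. -/
noncomputable def STL.obj {S : Type u} {k : Type v} [CommRing k] (δ : k) (x : ColorSeq S) : STL S δ :=
  (Quotient.functor (FreeTL.rel δ)).obj (Free.of k ((Paths.of (ColorSeq S)).obj x))

/-- The morphism represented by a diagram. -/
noncomputable def STL.ofDiagram {S : Type u} {k : Type v} [CommRing k] (δ : k) {x y : ColorSeq S}
    (p : TLDiagram x y) : STL.obj δ x ⟶ STL.obj δ y :=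
  (Quotient.functor (FreeTL.rel δ)).map (FreeTL.ofDiagram k p)

/-- All the cups and caps in the diagram are of the given kind. So `AllOfKind .cap` means that the
diagram is a cap diagram, and `AllOfKind .cup` that it is a cup diagram. -/
inductive TLDiagram.AllOfKind {S : Type u} (κ : TLKind) {x : ColorSeq S} :
    ∀ {y : ColorSeq S}, TLDiagram x y → Prop
  | nil : AllOfKind κ Quiver.Path.nil
  | cons {y z : ColorSeq S} (p : TLDiagram x y) (g : TLGen y z) :
      AllOfKind κ p → g.kind = κ → AllOfKind κ (Quiver.Path.cons p g)

/-- The span `I_{<x}` of the non-identity colored crossingless matchings in `End(x)`. A crossingless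
matching is a cap diagram `T : x ⟶ z` followed by a cup diagram `U : z ⟶ y`, where `z` is the
sequence of regions between the through-strands; if `y = x`, it is the identity matching precisely
when `T` has no caps (equivalently `U` has no cups). -/
noncomputable def STL.lowerIdeal {S : Type u} {k : Type v} [CommRing k] (δ : k) (x : ColorSeq S) :
    Submodule k (End (STL.obj δ x)) :=
  Submodule.span k {f | ∃ (z : ColorSeq S) (T : TLDiagram x z) (U : TLDiagram z x),
    TLDiagram.AllOfKind .cap T ∧ TLDiagram.AllOfKind .cup U ∧ T.length ≠ 0 ∧
    f = STL.ofDiagram δ T ≫ STL.ofDiagram δ U}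

/-- An indecomposable idempotent of a ring: a non-zero idempotent which is not the sum of two
non-zero orthogonal idempotents. -/
def IsIndecomposableIdempotent {R : Type*} [Ring R] (e : R) : Prop :=
  IsIdempotentElem e ∧ e ≠ 0 ∧
    ∀ f g : R, IsIdempotentElem f → IsIdempotentElem g → f * g = 0 → g * f = 0 → f + g = e →
      f = 0 ∨ g = 0

/-- The Karoubi envelope of the additive closure of the colored Temperley-Lieb category. -/
abbrev KarSTL (S : Type u) {k : Type v} [CommRing k] (δ : k) := Karoubi (Mat_ (STL S δ))

instance KarSTL.hasFiniteBiproducts (S : Type u) {k : Type v} [CommRing k] (δ : k) :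
    HasFiniteBiproducts (KarSTL S δ) :=
  inferInstance

instance KarSTL.hasBinaryBiproducts (S : Type u) {k : Type v} [CommRing k] (δ : k) :
    HasBinaryBiproducts (KarSTL S δ) :=
  HasBinaryBiproducts.of_hasBinaryProducts

/-- The sequence `x` as an object of the Karoubi envelope. -/
noncomputable def KarSTL.obj {S : Type u} {k : Type v} [CommRing k] (δ : k) (x : ColorSeq S) :
    KarSTL S δ :=
  (toKaroubi _).obj ((Mat_.embedding _).obj (STL.obj δ x))

/-- The image, in the Karoubi envelope, of an idempotent endomorphism of `x`. -/
noncomputable def KarSTL.image {S : Type u} {k : Type v} [CommRing k] (δ : k) (x : ColorSeq S)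
    (e : End (STL.obj δ x)) (he : IsIdempotentElem e) : KarSTL S δ where
  X := (Mat_.embedding _).obj (STL.obj δ x)
  p := (Mat_.embedding _).map e
  idem := by rw [← Functor.map_comp]; exact congrArg _ he

/-- A decomposition `𝟙 = ∑ eᵢ` of the identity of `x` into orthogonal indecomposable idempotents,
together with an index `top` for which `e_top` is the identity modulo `I_{<x}`. -/
structure TopDecomposition {S : Type u} {k : Type v} [CommRing k] (δ : k) (x : ColorSeq S) where
  n : ℕ
  e : Fin n → End (STL.obj δ x)
  complete : CompleteOrthogonalIdempotents e
  indecomposable : ∀ i, IsIndecomposableIdempotent (e i)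
  top : Fin n
  top_mod : e top - 1 ∈ STL.lowerIdeal δ x

/-- The object `V_x` determined by a decomposition: the image of its top idempotent. -/
noncomputable def TopDecomposition.V {S : Type u} {k : Type v} [CommRing k] {δ : k}
    {x : ColorSeq S} (d : TopDecomposition δ x) : KarSTL S δ :=
  KarSTL.image δ x (d.e d.top) (d.complete.idem d.top)

/-! The theorem combines Krull–Schmidt theory with a filtration of the morphisms by length. A cup
followed by a cap can be replaced by a cap followed by a cup, or by a scalar (`STL.cup_comp_cap`).
Hence caps followed by cups span all morphisms (`STL.mem_matchingSpan`). As `S` is finite, the Hom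
modules are finite over `k`, and `I_{<x}` is the two-sided ideal of sums of endomorphisms factoring
through shorter sequences. The quotient `End(x) / I_{<x}` is spanned by the class of the identity,
so an idempotent of `End(x)` becomes 0 or 1 there. Linear independence of the matchings is never
needed, only `1 ∉ I_{<x}` (`STL.one_notMem_lowerIdeal`). This follows from the spin representation
of the Temperley–Lieb relations over an algebraically closed field with `q + q⁻¹ = -δ`: a diagram
ending in a cup vanishes at the constant word, and the identity does not. Since `k` is complete
local, an indecomposable idempotent of a finite `k`-algebra has a local corner ring
(`IsIndecomposableIdempotent.exists_inverse`). In an idempotent complete category, an indecomposable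
object whose identity is a sum of morphisms through non-zero objects with local endomorphism rings
is isomorphic to one of these objects. By induction on length every identity is a sum of morphisms
through the objects `V_y`, which gives completeness of the list and the decomposition of `x`. If
`V_x ≅ V_y` with `y ≠ x` not longer than `x`, then `e_0` factors through `y` and lies in `I_{<x}`,
forcing `1 ∈ I_{<x}`. -/

/-! ### Finite free algebras over a complete local ring -/

section AdicallyComplete

variable {k : Type*} [CommRing k]

theorem Module.Basis.mem_ideal_smul_top_iff {M ι : Type*} [AddCommGroup M] [Module k M] [Fintype ι]
    (b : Module.Basis ι k M) (I : Ideal k) (x : M) :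
    x ∈ I • (⊤ : Submodule k M) ↔ ∀ i, b.repr x i ∈ I := by
  constructor
  · intro h i
    induction h using Submodule.smul_induction_on' with
    | smul r hr m _ =>
      rw [map_smul, Finsupp.smul_apply, smul_eq_mul]; exact I.mul_mem_right _ hr
    | add x _ y _ hx hy => rw [map_add, Finsupp.add_apply]; exact I.add_mem hx hy
  · intro h
    rw [← b.sum_repr x]
    exact Submodule.sum_mem _ fun i _ => Submodule.smul_mem_smul (h i) trivial

theorem IsAdicComplete.of_free (I : Ideal k) [IsAdicComplete I k] (M : Type*) [AddCommGroup M]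
    [Module k M] [Module.Free k M] [Module.Finite k M] : IsAdicComplete I M := by
  let b := Module.Free.chooseBasis k M
  have mem_self (J : Ideal k) (x : k) : x ∈ J • (⊤ : Submodule k k) ↔ x ∈ J := by simp
  refine { haus' := fun x hx => ?_, prec' := fun f hf => ?_ }
  · rw [← b.repr.map_eq_zero_iff]
    ext i
    refine IsHausdorff.haus (I := I) (M := k) inferInstance _ fun n => ?_
    have := hx n
    rw [SModEq.zero, b.mem_ideal_smul_top_iff] at this
    rw [SModEq.zero, mem_self]
    exact this i
  · have key (i) : ∃ L : k, ∀ n, b.repr (f n) i ≡ L [SMOD (I ^ n • ⊤ : Submodule k k)] := by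
      refine IsPrecomplete.prec (I := I) (M := k) inferInstance fun {m n} hmn => ?_
      have := hf hmn
      rw [SModEq.sub_mem, b.mem_ideal_smul_top_iff] at this
      rw [SModEq.sub_mem, mem_self]
      simpa using this i
    choose L hL using key
    refine ⟨∑ i, L i • b i, fun n => ?_⟩
    rw [SModEq.sub_mem, b.mem_ideal_smul_top_iff]
    intro i
    have := hL i n
    rw [SModEq.sub_mem, mem_self] at this
    rwa [map_sub, Finsupp.sub_apply, b.repr_sum_self]

/-- The filtrations of `B` by `I ^ n • B` and by powers of the extended ideal coincide. The second
form makes `B` Henselian along an ideal of its own. -/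
theorem IsAdicComplete.map_algebraMap (I : Ideal k) (B : Type*) [CommRing B] [Algebra k B]
    [IsAdicComplete I B] : IsAdicComplete (I.map (algebraMap k B)) B := by
  have mem_iff (n : ℕ) (x : B) : x ∈ ((I.map (algebraMap k B)) ^ n • ⊤ : Submodule B B) ↔
      x ∈ (I ^ n • ⊤ : Submodule k B) := by
    rw [Ideal.smul_top_eq_map]
    simp [Ideal.map_pow]
  refine { haus' := fun x hx => ?_, prec' := fun f hf => ?_ }
  · refine IsHausdorff.haus (I := I) (M := B) inferInstance _ fun n => ?_
    have := hx n
    rwa [SModEq.zero, mem_iff, ← SModEq.zero] at this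
  · obtain ⟨L, hL⟩ := IsPrecomplete.prec (I := I) (M := B) inferInstance (f := f) fun {m n} hmn => by
      have := hf hmn
      rwa [SModEq.sub_mem, mem_iff, ← SModEq.sub_mem] at this
    refine ⟨L, fun n => ?_⟩
    have := hL n
    rwa [SModEq.sub_mem, ← mem_iff, ← SModEq.sub_mem] at this

open Polynomial in
/-- Idempotents lift along a Henselian ideal. -/
theorem HenselianRing.exists_isIdempotentElem {B : Type*} [CommRing B] (I : Ideal B)
    [HenselianRing B I] (a : B) (ha : a * a - a ∈ I) :
    ∃ e : B, IsIdempotentElem e ∧ e - a ∈ I := by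
  nontriviality B
  -- The derivative of `X ^ 2 - X` at `a` is `2a - 1`, and `(2a - 1)² = 1 + 4(a² - a)`, so it is a
  -- unit modulo `I`.
  have hu : (Ideal.Quotient.mk I (2 * a - 1)) * (Ideal.Quotient.mk I (2 * a - 1)) = 1 := by
    rw [← map_mul, ← map_one (Ideal.Quotient.mk I), Ideal.Quotient.eq]
    convert I.mul_mem_left 4 ha using 1
    ring
  obtain ⟨e, he, hea⟩ := HenselianRing.is_henselian (I := I) (X ^ 2 - X : B[X])
    (monic_X_pow_sub (by rw [degree_X]; norm_num)) a (by simpa [sq] using ha)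
    (by
      have hd : (derivative (X ^ 2 - X : B[X])).eval a = 2 * a - 1 := by
        simp [one_add_one_eq_two]
      rw [hd]
      exact IsUnit.of_mul_eq_one _ hu)
  refine ⟨e, ?_, hea⟩
  have : e ^ 2 - e = 0 := by simpa using he
  rw [IsIdempotentElem, ← sq]
  exact sub_eq_zero.mp this

theorem isArtinian_quotient_maximalIdeal_smul_top [IsLocalRing k] (M : Type*) [AddCommGroup M]
    [Module k M] [Module.Finite k M] :
    IsArtinian k (M ⧸ (IsLocalRing.maximalIdeal k • ⊤ : Submodule k M)) := by
  let := Ideal.Quotient.field (IsLocalRing.maximalIdeal k)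
  have : Module.Finite (k ⧸ IsLocalRing.maximalIdeal k)
      (M ⧸ (IsLocalRing.maximalIdeal k • ⊤ : Submodule k M)) :=
    Module.Finite.of_restrictScalars_finite k _ _
  exact isArtinian_of_surjective_algebraMap (R := k ⧸ IsLocalRing.maximalIdeal k)
    Ideal.Quotient.mk_surjective

end AdicallyComplete

/-! ### Idempotents in finite algebras over a local ring -/

section LocalIdempotents

variable {k : Type*} [CommRing k] [IsLocalRing k]

/-- Over a complete local ring, a finite free commutative algebra splits into a part where `t` is
invertible and a part where `1 - t` is invertible. -/
theorem exists_isIdempotentElem_split [IsAdicComplete (IsLocalRing.maximalIdeal k) k]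
    {B : Type*} [CommRing B] [Algebra k B] [Module.Free k B] [Module.Finite k B] (t : B) :
    ∃ e t₁ t₂ : B, IsIdempotentElem e ∧ t * t₁ * e = e ∧ (1 - t) * t₂ * (1 - e) = 1 - e := by
  set I := (IsLocalRing.maximalIdeal k).map (algebraMap k B)
  have := IsAdicComplete.of_free (IsLocalRing.maximalIdeal k) B
  have := IsAdicComplete.map_algebraMap (IsLocalRing.maximalIdeal k) B
  have hjac : I ≤ Ideal.jacobson ⊥ := HenselianRing.jac
  have hart : IsArtinian k (B ⧸ I) := by
    have h := isArtinian_quotient_maximalIdeal_smul_top (k := k) B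
    rw [Ideal.smul_top_eq_map] at h
    exact h
  have : IsArtinianRing (B ⧸ I) := isArtinian_of_tower k hart
  -- in the quotient, the powers of `t` stabilize
  obtain ⟨n, s, hs⟩ : ∃ (n : ℕ) (s : B), t ^ (n + 1) * t ^ (n + 1) * s - t ^ (n + 1) ∈ I := by
    obtain ⟨n, y, hy⟩ := IsArtinian.exists_pow_succ_smul_dvd (Ideal.Quotient.mk I t) (1 : B ⧸ I)
    obtain ⟨y, rfl⟩ := Ideal.Quotient.mk_surjective y
    have h1 : Ideal.Quotient.mk I (t ^ n) = Ideal.Quotient.mk I (t ^ n * (t * y)) := by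
      simp only [smul_eq_mul, mul_one] at hy
      rw [map_pow, ← hy, pow_succ]; simp [mul_assoc]
    have h2 (m : ℕ) : Ideal.Quotient.mk I (t ^ n) = Ideal.Quotient.mk I (t ^ n * (t * y) ^ m) := by
      induction m with
      | zero => simp
      | succ m ih => rw [pow_succ, ← mul_assoc, mul_right_comm, map_mul _ (t ^ n * (t * y)), ← h1,
          ← map_mul]; exact ih
    refine ⟨n, y ^ (n + 1), ?_⟩
    rw [← Ideal.Quotient.eq, pow_succ t n, map_mul _ (t ^ n) t, h2 (n + 1), ← map_mul]
    congr 1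
    ring
  -- Fitting decomposition of `t` in `B / I`: `a` is idempotent there, `t` is invertible on `a` and
  -- nilpotent on `1 - a`. The exponent `n + 1` leaves a factor `t` to split off even when `n = 0`.
  set a := t ^ (n + 1) * s with ha
  obtain ⟨e, he, hea⟩ := HenselianRing.exists_isIdempotentElem I a (by
    convert I.mul_mem_right s hs using 1; rw [ha]; ring)
  have unit_of_mem {c : B} (hc : c ∈ I) : ∃ w, (1 + c) * w = 1 := by
    have := Ideal.mem_jacobson_bot.mp (hjac hc) 1
    obtain ⟨w, hw⟩ := this.exists_right_inv
    exact ⟨w, by simpa [add_comm] using hw⟩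
  -- correction of inverses modulo `I` to inverses
  have correct (u v f : B) (hf : IsIdempotentElem f) (h : u * v * f - f ∈ I) :
      ∃ v', u * v' * f = f := by
    obtain ⟨w, hw⟩ := unit_of_mem h
    refine ⟨v * w, ?_⟩
    have hff : f * f = f := hf
    linear_combination f * hw + (w - u * v * w) * hff
  obtain ⟨t₁, h₁⟩ := correct t (t ^ n * s) e he (by
    have : t * (t ^ n * s) * e - e = (a - e) * e := by
      have hee : e * e = e := he
      rw [ha]; linear_combination hee
    rw [this]
    exact I.mul_mem_right _ (by rw [← neg_sub]; exact I.neg_mem hea))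
  -- Modulo `I`, `t ^ (n + 1)` vanishes on `1 - e`, so the geometric sum inverts `1 - t` there.
  obtain ⟨t₂, h₂⟩ := correct (1 - t) (∑ i ∈ Finset.range (n + 1), t ^ i) (1 - e) he.one_sub (by
    have hgeom := mul_neg_geom_sum t (n + 1)
    have : (1 - t) * (∑ i ∈ Finset.range (n + 1), t ^ i) * (1 - e) - (1 - e) =
        t ^ (n + 1) * (e - a) + (t ^ (n + 1) * t ^ (n + 1) * s - t ^ (n + 1)) := by
      rw [hgeom, ha]; ring
    rw [this]
    exact I.add_mem (I.mul_mem_left _ hea) hs)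
  exact ⟨e, t₁, t₂, he, h₁, h₂⟩

/-- The corner ring of an indecomposable idempotent of an integral algebra over a complete local
ring is local. -/
theorem IsIndecomposableIdempotent.exists_inverse [IsAdicComplete (IsLocalRing.maximalIdeal k) k]
    {A : Type*} [Ring A] [Algebra k A] [Algebra.IsIntegral k A] {e : A}
    (he : IsIndecomposableIdempotent e) {a : A} (hea : e * a = a) (hae : a * e = a) :
    (∃ b, a * b = e ∧ b * a = e) ∨ ∃ b, (e - a) * b = e ∧ b * (e - a) = e := by
  -- The subalgebra generated by `a` is commutative but need not be free. It is replaced by `k[X] /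
  -- (f)` with `f` monic and `f(a) = 0`, which is finite free. Then `b ↦ e * φ b` is multiplicative,
  -- sends 1 to `e` and the root to `a`.
  obtain ⟨f, hf, hfa⟩ := Algebra.IsIntegral.isIntegral (R := k) a
  have := hf.free_adjoinRoot
  have := hf.finite_adjoinRoot
  let φ : AdjoinRoot f →+* A := Ideal.Quotient.lift _ (Polynomial.aeval a).toRingHom fun p hp => by
    obtain ⟨q, rfl⟩ := Ideal.mem_span_singleton'.mp hp
    have : Polynomial.aeval a f = 0 := hfa
    simp [this]
  have hcomm (b : AdjoinRoot f) : e * φ b = φ b * e := by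
    obtain ⟨p, rfl⟩ := AdjoinRoot.mk_surjective b
    change e * Polynomial.aeval a p = Polynomial.aeval a p * e
    have hc : Commute e a := by rw [Commute, SemiconjBy, hea, hae]
    induction p using Polynomial.induction_on' with
    | add p q hp hq => rw [map_add, mul_add, add_mul, hp, hq]
    | monomial n r =>
      rw [Polynomial.aeval_monomial, ← mul_assoc, ← Algebra.commutes, mul_assoc,
        (hc.pow_right n).eq, mul_assoc]
  have hmul (b c : AdjoinRoot f) : e * φ b * (e * φ c) = e * φ (b * c) := by
    rw [hcomm b, mul_assoc, ← mul_assoc e e, he.1, ← mul_assoc, ← hcomm b, map_mul, mul_assoc]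
  have hroot : e * φ (AdjoinRoot.root f) = a := by
    have : φ (AdjoinRoot.root f) = a := Polynomial.aeval_X a
    rw [this, hea]
  have hsub : e * φ (1 - AdjoinRoot.root f) = e - a := by
    rw [map_sub, mul_sub, hroot, map_one, mul_one]
  have hadd (b : AdjoinRoot f) : e * φ b + e * φ (1 - b) = e := by
    rw [← mul_add, ← map_add, add_sub_cancel, map_one, mul_one]
  obtain ⟨ε, t₁, t₂, hε, h₁, h₂⟩ := exists_isIdempotentElem_split (k := k) (AdjoinRoot.root f)
  have key (u v w : AdjoinRoot f) (h : u * v * w = w) (hw : e * φ w = e) :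
      e * φ u * (e * φ v) = e ∧ e * φ v * (e * φ u) = e := by
    have : e * φ (u * v) = e := by
      calc e * φ (u * v) = e * φ (u * v) * (e * φ w) := by
            rw [hw, hcomm, mul_assoc, he.1]
        _ = e := by rw [hmul, h, hw]
    exact ⟨by rw [hmul, this], by rw [hmul, mul_comm v, this]⟩
  -- Indecomposability kills one of the two halves of `e`; on the surviving one `a` or `e - a` is
  -- invertible.
  rcases he.2.2 (e * φ ε) (e * φ (1 - ε)) (by rw [IsIdempotentElem, hmul, hε])
    (by rw [IsIdempotentElem, hmul, hε.one_sub]) (by rw [hmul, hε.mul_one_sub_self]; simp)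
    (by rw [hmul, hε.one_sub_mul_self]; simp) (hadd ε) with h | h
  · right
    have := key _ _ _ h₂ (by have := hadd ε; rwa [h, zero_add] at this)
    rw [hsub] at this
    exact ⟨_, this⟩
  · left
    have := key _ _ _ h₁ (by have := hadd ε; rwa [h, add_zero] at this)
    rw [hroot] at this
    exact ⟨_, this⟩

/-- Nakayama's lemma for the finitely generated module `eA`, which equals `𝔪 • eA`. -/
theorem IsIdempotentElem.eq_zero_of_mem_maximalIdeal_smul_top {A : Type*} [Ring A] [Algebra k A]
    [Module.Finite k A] {e : A} (he : IsIdempotentElem e)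
    (h : e ∈ (IsLocalRing.maximalIdeal k • ⊤ : Submodule k A)) : e = 0 := by
  have hbot : LinearMap.range (LinearMap.mulLeft k e) = ⊥ := by
    refine Submodule.eq_bot_of_le_smul_of_le_jacobson_bot (IsLocalRing.maximalIdeal k) _
      (Module.Finite.iff_fg.mp inferInstance) ?_ (IsLocalRing.maximalIdeal_le_jacobson _)
    rintro _ ⟨a, rfl⟩
    have h1 : e * a ∈ (IsLocalRing.maximalIdeal k • ⊤ : Submodule k A) := by
      have := Submodule.mem_map_of_mem (f := LinearMap.mulRight k a) h
      rw [Submodule.map_smul''] at this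
      exact Submodule.smul_mono le_rfl le_top this
    have h2 := Submodule.mem_map_of_mem (f := LinearMap.mulLeft k e) h1
    rw [Submodule.map_smul'', Submodule.map_top, LinearMap.mulLeft_apply, ← mul_assoc, he] at h2
    exact h2
  have : e ∈ LinearMap.range (LinearMap.mulLeft k e) := ⟨e, he⟩
  rwa [hbot] at this

/-- Splitting idempotents terminates: the image of `eA` in the Artinian module `A / 𝔪A` strictly
shrinks when a non-zero orthogonal summand is removed from `e`. Completeness of `k` plays no role
here. -/
theorem IsIdempotentElem.exists_decomposition {A : Type*} [Ring A] [Algebra k A]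
    [Module.Finite k A] {e : A} (he : IsIdempotentElem e) :
    ∃ (n : ℕ) (f : Fin n → A), OrthogonalIdempotents f ∧ (∀ i, IsIndecomposableIdempotent (f i)) ∧
      ∑ i, f i = e := by
  let 𝔪A : Submodule k A := IsLocalRing.maximalIdeal k • ⊤
  let N (e : A) : Submodule k (A ⧸ 𝔪A) := (LinearMap.range (LinearMap.mulLeft k e)).map 𝔪A.mkQ
  have : IsArtinian k (A ⧸ 𝔪A) := isArtinian_quotient_maximalIdeal_smul_top A
  have hlt {f g : A} (hf : IsIdempotentElem f) (hg : IsIdempotentElem g) (hfg : f * g = 0)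
      (hgf : g * f = 0) (hg0 : g ≠ 0) : N f < N (f + g) := by
    refine lt_of_le_of_ne (Submodule.map_mono ?_) fun heq => hg0 ?_
    · rintro _ ⟨a, rfl⟩
      exact ⟨f * a, by simp [add_mul, ← mul_assoc, hf.eq, hgf]⟩
    -- If the images agree, then `g ≡ f * a` modulo `𝔪A`. Multiplying by `g` on the left gives `g ∈
    -- 𝔪A`, so `g = 0`.
    · have hgN : 𝔪A.mkQ g ∈ N (f + g) :=
        Submodule.mem_map_of_mem ⟨g, by simp [add_mul, hfg, hg.eq]⟩
      rw [← heq] at hgN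
      obtain ⟨_, ⟨a, rfl⟩, ha⟩ := hgN
      rw [← sub_eq_zero, ← map_sub, Submodule.mkQ_apply, Submodule.Quotient.mk_eq_zero] at ha
      refine hg.eq_zero_of_mem_maximalIdeal_smul_top (k := k) ?_
      have := Submodule.mem_map_of_mem (f := LinearMap.mulLeft k g) ha
      rw [Submodule.map_smul''] at this
      have := Submodule.smul_mono le_rfl le_top this
      simp only [LinearMap.mulLeft_apply, mul_sub, ← mul_assoc, hgf, zero_mul, hg.eq,
        zero_sub] at this
      exact neg_mem_iff.mp this
  induction hM : N e using WellFoundedLT.induction generalizing e with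
  | ind M ih =>
  subst hM
  by_cases h0 : e = 0
  · subst h0
    exact ⟨0, Fin.elim0, ⟨fun i => i.elim0, fun i => i.elim0⟩, fun i => i.elim0, by simp⟩
  by_cases hind : IsIndecomposableIdempotent e
  · exact ⟨1, fun _ => e, ⟨fun _ => he, fun i j hij => (hij (Subsingleton.elim _ _)).elim⟩,
      fun _ => hind, by simp⟩
  obtain ⟨f, g, hf, hg, hfg, hgf, rfl, hf0, hg0⟩ : ∃ f g : A, IsIdempotentElem f ∧
      IsIdempotentElem g ∧ f * g = 0 ∧ g * f = 0 ∧ f + g = e ∧ f ≠ 0 ∧ g ≠ 0 := by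
    by_contra! hcon
    refine hind ⟨he, h0, fun f g hf hg hfg hgf hs => ?_⟩
    by_contra! hne
    exact hne.2 (hcon f g hf hg hfg hgf hs hne.1)
  obtain ⟨n, p, hp, hpi, hps⟩ := ih _ (hlt hf hg hfg hgf hg0) hf rfl
  obtain ⟨m, q, hq, hqi, hqs⟩ := ih _ (add_comm f g ▸ hlt hg hf hgf hfg hf0) hg rfl
  have pf (i) : p i * f = p i ∧ f * p i = p i := by
    rw [← hps]
    exact ⟨hp.mul_sum_of_mem (Finset.mem_univ i), by simp [Finset.sum_mul, hp.mul_eq]⟩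
  have qg (i) : q i * g = q i ∧ g * q i = q i := by
    rw [← hqs]
    exact ⟨hq.mul_sum_of_mem (Finset.mem_univ i), by simp [Finset.sum_mul, hq.mul_eq]⟩
  refine ⟨n + m, Fin.append p q, ⟨fun i => ?_, fun i j hij => ?_⟩, fun i => ?_, ?_⟩
  · refine i.addCases (fun i => ?_) fun i => ?_
    · simpa using hp.idem i
    · simpa using hq.idem i
  · induction i using Fin.addCases with
    | left i =>
      induction j using Fin.addCases with
      | left j => simpa using hp.ortho (by rintro rfl; exact hij rfl)
      | right j =>
        simp only [Fin.append_left, Fin.append_right]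
        rw [← (pf i).1, ← (qg j).2, mul_assoc, ← mul_assoc f, hfg, zero_mul, mul_zero]
    | right i =>
      induction j using Fin.addCases with
      | left j =>
        simp only [Fin.append_left, Fin.append_right]
        rw [← (qg i).1, ← (pf j).2, mul_assoc, ← mul_assoc g, hgf, zero_mul, mul_zero]
      | right j => simpa using hq.ortho (by rintro rfl; exact hij rfl)
  · refine i.addCases (fun i => ?_) fun i => ?_
    · simpa using hpi i
    · simpa using hqi i
  · rw [Fin.sum_univ_add]
    simp [hps, hqs]

end LocalIdempotents

/-! ### Diagrams in the free linear category -/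

section FreeCategory

variable {S : Type u} {k : Type v} [CommRing k]

theorem FreeTL.ofDiagram_comp {x y z : ColorSeq S} (p : TLDiagram x y) (q : TLDiagram y z) :
    FreeTL.ofDiagram k (p.comp q) = FreeTL.ofDiagram k p ≫ FreeTL.ofDiagram k q :=
  (Free.embedding k (Paths (ColorSeq S))).map_comp (X := x) (Y := y) (Z := z) p q

theorem FreeTL.ofDiagram_nil (x : ColorSeq S) :
    FreeTL.ofDiagram k (Quiver.Path.nil : TLDiagram x x) = 𝟙 _ :=
  rfl

theorem FreeTL.mem_span_ofDiagram {x y : ColorSeq S}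
    (f : (Free.of k ((Paths.of (ColorSeq S)).obj x) : FreeTL S k) ⟶
      Free.of k ((Paths.of (ColorSeq S)).obj y)) :
    f ∈ Submodule.span k (Set.range (FreeTL.ofDiagram k (x := x) (y := y))) := by
  have h : f = Finsupp.sum f fun p r => r • FreeTL.ofDiagram k p := by
    refine (Finsupp.sum_single f).symm.trans (Finsupp.sum_congr fun p _ => ?_)
    exact (Finsupp.smul_single_one p _).symm
  rw [h]
  exact Submodule.sum_mem _ fun p _ => Submodule.smul_mem _ _ (Submodule.subset_span ⟨p, rfl⟩)

end FreeCategory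

/-! ### The spin representation, on functions of infinite words so that all sequences act on one
space -/

section SpinModel

/-- Insert the letters `a` and `b` at the positions `i` and `i + 1` of an infinite word. -/
def insertPair (i : ℕ) (a b : Bool) (w : ℕ → Bool) (n : ℕ) : Bool :=
  if n < i then w n else if n = i then a else if n = i + 1 then b else w (n - 2)

/-- Delete the letters at the positions `i` and `i + 1` of an infinite word. -/
def deletePair (i : ℕ) (w : ℕ → Bool) (n : ℕ) : Bool :=
  if n < i then w n else w (n + 2)

section words

variable (w : ℕ → Bool) (a b c d : Bool) (i j : ℕ)

theorem insertPair_left : insertPair i a b w i = a := by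
  simp [insertPair]

theorem insertPair_right : insertPair i a b w (i + 1) = b := by
  simp [insertPair]

theorem insertPair_of_lt {n : ℕ} (h : n < i) : insertPair i a b w n = w n := by
  simp [insertPair, h]

theorem insertPair_of_le {n : ℕ} (h : i ≤ n) : insertPair i a b w (n + 2) = w n := by
  simp only [insertPair]; grind

theorem deletePair_of_lt {n : ℕ} (h : n < i) : deletePair i w n = w n := by
  simp [deletePair, h]

theorem deletePair_of_le {n : ℕ} (h : i ≤ n) : deletePair i w n = w (n + 2) := by
  simp only [deletePair]; grind

theorem deletePair_insertPair : deletePair i (insertPair i a b w) = w := by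
  funext n; simp only [deletePair, insertPair]; grind

theorem deletePair_insertPair_succ :
    deletePair i (insertPair (i + 1) a b w) = Function.update w i b := by
  funext n; simp only [deletePair, insertPair, Function.update]; grind

theorem deletePair_succ_insertPair :
    deletePair (i + 1) (insertPair i a b w) = Function.update w i a := by
  funext n; simp only [deletePair, insertPair, Function.update]; grind

variable {i j}

theorem insertPair_insertPair (h : i ≤ j) :
    insertPair i a b (insertPair j c d w) = insertPair (j + 2) c d (insertPair i a b w) := by
  funext n; simp only [insertPair]; grind

theorem deletePair_insertPair_of_le (h : i ≤ j) :
    deletePair (j + 2) (insertPair i a b w) = insertPair i a b (deletePair j w) := by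
  funext n; simp only [deletePair, insertPair]; grind

theorem deletePair_insertPair_of_ge (h : i ≤ j) :
    deletePair i (insertPair (j + 2) a b w) = insertPair j a b (deletePair i w) := by
  funext n; simp only [deletePair, insertPair]; grind

theorem deletePair_deletePair (h : i ≤ j) :
    deletePair i (deletePair (j + 2) w) = deletePair j (deletePair i w) := by
  funext n; simp only [deletePair]; grind

end words

variable {k : Type*} {K : Type*} [CommRing k] [Field K] [Algebra k K] (q : K)

/-- The weights of a cap. -/
def capWeight : Bool → Bool → K
  | false, true => q
  | true, false => 1
  | _, _ => 0

/-- The weights of a cup. -/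
def cupWeight : Bool → Bool → K
  | false, true => 1
  | true, false => q⁻¹
  | _, _ => 0

variable (k) in
/-- The cap or cup at the positions `i` and `i + 1`, acting on functions of infinite words. -/
def spinOperator : TLKind → ℕ → Module.End k ((ℕ → Bool) → K)
  | .cap, i =>
    { toFun F w := ∑ a, ∑ b, capWeight q a b * F (insertPair i a b w)
      map_add' F G := by funext w; simp; ring
      map_smul' r F := by funext w; simp [smul_add] }
  | .cup, i =>
    { toFun F w := cupWeight q (w i) (w (i + 1)) * F (deletePair i w)
      map_add' F G := by funext w; simp; ring
      map_smul' r F := by funext w; simp }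

variable {q}

theorem spinOperator_cap_apply (i : ℕ) (F : (ℕ → Bool) → K) (w : ℕ → Bool) :
    spinOperator k q .cap i F w = ∑ a, ∑ b, capWeight q a b * F (insertPair i a b w) :=
  rfl

theorem spinOperator_cup_apply (i : ℕ) (F : (ℕ → Bool) → K) (w : ℕ → Bool) :
    spinOperator k q .cup i F w = cupWeight q (w i) (w (i + 1)) * F (deletePair i w) :=
  rfl

/-- The non-zero products of a cap weight and a cup weight on the same pair are `q * 1` and `1 *
q⁻¹`. -/
theorem spinOperator_circle {δ : k} (hδ : q + q⁻¹ = -algebraMap k K δ) (i : ℕ) :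
    spinOperator k q .cap i * spinOperator k q .cup i = -δ • 1 := by
  refine LinearMap.ext fun F => funext fun w => ?_
  have : -(algebraMap k K δ * F w) = (q + q⁻¹) * F w := by rw [hδ]; ring
  simp [spinOperator_cap_apply, spinOperator_cup_apply, deletePair_insertPair, insertPair_left,
    insertPair_right, capWeight, cupWeight, Algebra.smul_def, this]
  ring

/-- The 2×2 matrices of cap weights and of cup weights are inverse to each other. -/
theorem spinOperator_zigzag_left (hq : q ≠ 0) (i : ℕ) :
    spinOperator k q .cap (i + 1) * spinOperator k q .cup i = 1 := by
  refine LinearMap.ext fun F => funext fun w => ?_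
  have hw := Function.update_eq_self i w
  cases h : w i <;> rw [h] at hw <;>
    simp [spinOperator_cap_apply, spinOperator_cup_apply, deletePair_insertPair_succ,
      insertPair_left, insertPair_of_lt, capWeight, cupWeight, h, hw, hq]

theorem spinOperator_zigzag_right (hq : q ≠ 0) (i : ℕ) :
    spinOperator k q .cap i * spinOperator k q .cup (i + 1) = 1 := by
  refine LinearMap.ext fun F => funext fun w => ?_
  have hw := Function.update_eq_self i w
  cases h : w i <;> rw [h] at hw <;>
    simp [spinOperator_cap_apply, spinOperator_cup_apply, deletePair_succ_insertPair,
      insertPair_right, insertPair_of_le, add_assoc, capWeight, cupWeight, h, hw, hq]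

/-- The number of strands at the bottom of a cap or cup. -/
def TLKind.width : TLKind → ℕ
  | .cap => 2
  | .cup => 0

/-- The number of strands at the top of a cap or cup. -/
def TLKind.coWidth : TLKind → ℕ
  | .cap => 0
  | .cup => 2

/-- Here `j` is the position of the right-hand generator when the strands of the left-hand one are
ignored; `width` and `coWidth` add those strands below or above it. The four cases say that
insertions and deletions at disjoint places commute. -/
theorem spinOperator_interchange (κ κ' : TLKind) (i j : ℕ) (h : i ≤ j) :
    spinOperator k q κ' (j + κ.coWidth) * spinOperator k q κ i =
      spinOperator k q κ i * spinOperator k q κ' (j + κ.width) := by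
  refine LinearMap.ext fun F => funext fun w => ?_
  have h1 : j + 2 + 1 = j + 1 + 2 := by omega
  cases κ <;> cases κ' <;> simp only [TLKind.width, TLKind.coWidth, add_zero, Module.End.mul_apply]
  · simp only [spinOperator_cap_apply, insertPair_insertPair _ _ _ _ _ h, Fintype.sum_bool]
    ring
  · simp only [spinOperator_cap_apply, spinOperator_cup_apply, Fintype.sum_bool, h1,
      deletePair_insertPair_of_le _ _ _ h, insertPair_of_le _ _ _ _ h,
      insertPair_of_le _ _ _ _ (Nat.le_succ_of_le h)]
    ring
  · simp only [spinOperator_cap_apply, spinOperator_cup_apply, Fintype.sum_bool,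
      deletePair_insertPair_of_ge _ _ _ h,
      insertPair_of_lt _ _ _ _ (show i < j + 2 by omega),
      insertPair_of_lt _ _ _ _ (show i + 1 < j + 2 by omega)]
    ring
  · simp only [spinOperator_cup_apply, h1,
      deletePair_deletePair _ h, deletePair_of_le _ _ h,
      deletePair_of_le _ _ (Nat.le_succ_of_le h),
      deletePair_of_lt _ _ (show i < j + 2 by omega),
      deletePair_of_lt _ _ (show i + 1 < j + 2 by omega)]
    ring

variable {S : Type u}

variable (k q) in
/-- The operator on functions of infinite words represented by a diagram. -/
def spinAction {x y : ColorSeq S} (p : TLDiagram x y) : Module.End k ((ℕ → Bool) → K) :=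
  match p with
  | .nil => 1
  | .cons p g => spinOperator k q (TLGen.kind g) (TLGen.left g).length * spinAction p

theorem spinAction_comp {x y z : ColorSeq S} (p : TLDiagram x y) (p' : TLDiagram y z) :
    spinAction k q (p.comp p') = spinAction k q p' * spinAction k q p := by
  induction p' with
  | nil => simp [spinAction]
  | cons p' g ih => rw [Quiver.Path.comp_cons, spinAction, ih, spinAction, mul_assoc]

theorem spinAction_two {x y z : ColorSeq S} (g : TLGen x y) (h : TLGen y z) :
    spinAction k q (g.two h) =
      spinOperator k q h.kind h.left.length * spinOperator k q g.kind g.left.length := by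
  rw [TLGen.two, spinAction_comp]
  simp [spinAction, TLGen.one, Quiver.Hom.toPath]

theorem TLGen.length_src_add {x y : ColorSeq S} (g : TLGen x y) :
    x.colors.length = g.left.length + g.kind.width + 1 + g.right.length := by
  rw [g.src_eq]; cases g.kind <;> simp [TLKind.src, TLKind.width] <;> omega

theorem TLGen.length_tgt_add {x y : ColorSeq S} (g : TLGen x y) :
    y.colors.length = g.left.length + g.kind.coWidth + 1 + g.right.length := by
  rw [g.tgt_eq]; cases g.kind <;> simp [TLKind.tgt, TLKind.coWidth] <;> omega

theorem TLKind.length_src (κ : TLKind) (b r : S) : (κ.src b r).length = κ.width + 1 := by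
  cases κ <;> rfl

theorem spinAction_rel (hq : q ≠ 0) {δ : k} (hδ : q + q⁻¹ = -algebraMap k K δ)
    {x y : ColorSeq S} {p p' : TLDiagram x y} {c : k} (h : TLRel δ p c p') :
    spinAction k q p = c • spinAction k q p' := by
  cases h with
  | interchange g h h' g' g_kind g_outer g_inner h_kind h_outer h_inner g_left h_right disjoint =>
    rw [TLKind.length_src] at disjoint
    -- The relation fixes only what lies left of `g` and right of `h`; the positions of `h` and `h'`
    -- are recovered by counting colors.
    obtain ⟨j, hj⟩ := Nat.exists_eq_add_of_le (show g.left.length + g.kind.width ≤ h'.left.length by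
      omega)
    have e1 := g.length_src_add
    have e2 := g.length_tgt_add
    have e3 := h.length_src_add
    have e4 := h'.length_src_add
    rw [h_kind, h_right] at e4
    have hj' : h'.left.length = g.left.length + j + g.kind.width := by omega
    have hh : h.left.length = g.left.length + j + g.kind.coWidth := by omega
    rw [spinAction_two, spinAction_two, h_kind, g_kind, g_left, hj', hh, one_smul,
      spinOperator_interchange _ _ _ _ (Nat.le_add_right _ _)]
  | zigzag_left u w b r g h g_eq h_eq =>
    rw [spinAction_two, g_eq.1, g_eq.2.2.2.1, h_eq.1, h_eq.2.2.2.1, List.length_append,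
      List.length_singleton, spinOperator_zigzag_left hq, one_smul, spinAction]
  | zigzag_right u w b r g h g_eq h_eq =>
    rw [spinAction_two, g_eq.1, g_eq.2.2.2.1, h_eq.1, h_eq.2.2.2.1, List.length_append,
      List.length_singleton, spinOperator_zigzag_right hq, one_smul, spinAction]
  | circle u w b r g h g_eq h_eq =>
    rw [spinAction_two, g_eq.1, g_eq.2.2.2.1, h_eq.1, h_eq.2.2.2.1, spinOperator_circle hδ,
      spinAction]

variable (k q) in
/-- The linear extension of `spinAction`. -/
noncomputable def spinLinear (x y : ColorSeq S) :
    ((Free.of k ((Paths.of (ColorSeq S)).obj x) : FreeTL S k) ⟶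
      Free.of k ((Paths.of (ColorSeq S)).obj y)) →ₗ[k] Module.End k ((ℕ → Bool) → K) :=
  Finsupp.linearCombination k (spinAction k q (x := x) (y := y))

theorem spinLinear_ofDiagram {x y : ColorSeq S} (p : TLDiagram x y) :
    spinLinear k q x y (FreeTL.ofDiagram k p) = spinAction k q p :=
  (Finsupp.linearCombination_single k 1 p).trans (one_smul _ _)

theorem spinLinear_comp {x y z : ColorSeq S}
    (f : (Free.of k ((Paths.of (ColorSeq S)).obj x) : FreeTL S k) ⟶
      Free.of k ((Paths.of (ColorSeq S)).obj y))
    (g : (Free.of k ((Paths.of (ColorSeq S)).obj y) : FreeTL S k) ⟶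
      Free.of k ((Paths.of (ColorSeq S)).obj z)) :
    spinLinear k q x z (f ≫ g) = spinLinear k q y z g * spinLinear k q x y f := by
  induction FreeTL.mem_span_ofDiagram f using Submodule.span_induction with
  | zero => simp
  | add f f' _ _ h h' => rw [Preadditive.add_comp, map_add, map_add, h, h', mul_add]
  | smul r f _ h => rw [Linear.smul_comp, map_smul, map_smul, h, mul_smul_comm]
  | mem f hf =>
    obtain ⟨p, rfl⟩ := hf
    induction FreeTL.mem_span_ofDiagram g using Submodule.span_induction with
    | zero => simp
    | add g g' _ _ h h' => rw [Preadditive.comp_add, map_add, map_add, h, h', add_mul]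
    | smul r g _ h => rw [Linear.comp_smul, map_smul, map_smul, h, smul_mul_assoc]
    | mem g hg =>
      obtain ⟨p', rfl⟩ := hg
      rw [← FreeTL.ofDiagram_comp, spinLinear_ofDiagram, spinLinear_ofDiagram,
        spinLinear_ofDiagram, spinAction_comp]

theorem spinLinear_eq_zero (hq : q ≠ 0) {δ : k} (hδ : q + q⁻¹ = -algebraMap k K δ)
    {x y : ColorSeq S} {f : (Free.of k ((Paths.of (ColorSeq S)).obj x) : FreeTL S k) ⟶
      Free.of k ((Paths.of (ColorSeq S)).obj y)} (hf : f ∈ FreeTL.relIdeal δ _ _) :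
    spinLinear k q x y f = 0 := by
  induction hf using Submodule.span_induction with
  | zero => simp
  | add f f' _ _ h h' => rw [map_add, h, h', add_zero]
  | smul r f _ h => rw [map_smul, h, smul_zero]
  | mem f hf =>
    obtain ⟨x', y', p, p', c, a, b, h, rfl⟩ := hf
    rw [spinLinear_comp, spinLinear_comp, map_sub, map_smul, spinLinear_ofDiagram,
      spinLinear_ofDiagram, spinAction_rel hq hδ h, sub_self, mul_zero, zero_mul]

/-- Every cap removes two strands and every cup adds two, so the endpoints determine the number of
generators. This bounds normal forms and shows that a matching from `x` to `x` has as many cups as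
caps. -/
theorem TLDiagram.AllOfKind.length_eq {κ : TLKind} {x y : ColorSeq S} {p : TLDiagram x y}
    (hp : p.AllOfKind κ) :
    x.length + p.length * κ.coWidth = y.length + p.length * κ.width := by
  induction hp with
  | nil => simp
  | cons p g hp hg ih =>
    have h1 := g.length_src_add
    have h2 := g.length_tgt_add
    subst hg
    simp only [Quiver.Path.length_cons, ColorSeq.length, add_mul] at *
    omega

/-- A diagram ending with a cup does not act like the identity. -/
theorem spinAction_apply_false_eq_zero {x y : ColorSeq S} {p : TLDiagram x y}
    (hp : p.AllOfKind .cup) (h0 : p.length ≠ 0) (F : (ℕ → Bool) → K) :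
    spinAction k q p F (fun _ => false) = 0 := by
  cases hp with
  | nil => simp at h0
  | cons p g hp hg => simp [spinAction, hg, spinOperator_cup_apply, cupWeight]

end SpinModel

theorem exists_add_inv_eq {K : Type*} [Field K] [IsAlgClosed K] (d : K) :
    ∃ q : K, q ≠ 0 ∧ q + q⁻¹ = d := by
  obtain ⟨q, hq⟩ := IsAlgClosed.exists_root
    (Polynomial.X ^ 2 - Polynomial.C d * Polynomial.X + 1 : Polynomial K) (by
      have : (Polynomial.X ^ 2 - Polynomial.C d * Polynomial.X + 1 : Polynomial K).degree = 2 := by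
        compute_degree!
      rw [this]; norm_num)
  have h : q ^ 2 - d * q + 1 = 0 := by simpa using hq
  have h0 : q ≠ 0 := by rintro rfl; simp at h
  refine ⟨q, h0, ?_⟩
  field_simp
  linear_combination h

/-- Evaluation at the constant word kills each spanning element of `I_{<x}`, since such an element
has a cup on top, but does not kill the identity acting on the constant function 1. -/
theorem STL.one_notMem_lowerIdeal {S : Type u} {k : Type v} [CommRing k] [IsLocalRing k] (δ : k)
    (x : ColorSeq S) : (1 : End (STL.obj δ x)) ∉ STL.lowerIdeal δ x := by
  let K := AlgebraicClosure (IsLocalRing.ResidueField k)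
  obtain ⟨q, hq, hδ⟩ := exists_add_inv_eq (-algebraMap k K δ)
  -- The representation is defined on the free category, so a lift is carried along; that relations
  -- act by zero is used only when this lift is compared with the identity.
  have key : ∀ f ∈ STL.lowerIdeal δ x,
      ∃ f' : (Free.of k ((Paths.of (ColorSeq S)).obj x) : FreeTL S k) ⟶
        Free.of k ((Paths.of (ColorSeq S)).obj x),
        (Quotient.functor (FreeTL.rel δ)).map f' = f ∧
        ∀ F : (ℕ → Bool) → K, spinLinear k q x x f' F (fun _ => false) = 0 := by
    intro f hf
    induction hf using Submodule.span_induction with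
    | zero => exact ⟨0, Functor.map_zero _ _ _, by simp⟩
    | add f g _ _ hf hg =>
      obtain ⟨f', rfl, hf⟩ := hf
      obtain ⟨g', rfl, hg⟩ := hg
      exact ⟨f' + g', Functor.map_add _, fun F => by simp [hf, hg]⟩
    | smul r f _ hf =>
      obtain ⟨f', rfl, hf⟩ := hf
      exact ⟨r • f', rfl, fun F => by simp [hf]⟩
    | mem f hf =>
      obtain ⟨z, T, U, hT, hU, h0, rfl⟩ := hf
      refine ⟨FreeTL.ofDiagram k T ≫ FreeTL.ofDiagram k U, Functor.map_comp _ _ _, fun F => ?_⟩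
      have h1 := hT.length_eq
      have h2 := hU.length_eq
      simp only [TLKind.coWidth, TLKind.width] at h1 h2
      rw [spinLinear_comp, spinLinear_ofDiagram, spinLinear_ofDiagram, Module.End.mul_apply,
        spinAction_apply_false_eq_zero hU (by omega)]
  intro h1
  obtain ⟨f, hf, hF⟩ := key _ h1
  have hrel : FreeTL.rel δ f (𝟙 _) :=
    (Quotient.functor_map_eq_iff (FreeTL.rel δ) f (𝟙 _)).mp
      (hf.trans (CategoryTheory.Functor.map_id (Quotient.functor (FreeTL.rel δ)) _).symm)
  have h := spinLinear_eq_zero hq hδ hrel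
  rw [map_sub, ← FreeTL.ofDiagram_nil, spinLinear_ofDiagram, spinAction, sub_eq_zero] at h
  have := hF (fun _ => 1)
  rw [h] at this
  exact one_ne_zero this

/-! ### Normal form: caps below cups -/

section NormalForm

variable {S : Type u} {k : Type v} [CommRing k] (δ : k)

theorem ColorSeq.ext_colors {x y : ColorSeq S} (h : x.colors = y.colors) : x = y := by
  cases x; cases y; cases h; rfl

theorem List.IsChain.remove_turn {l r : List S} {c s : S}
    (h : (l ++ [c, s, c] ++ r).IsChain (fun a b => a ≠ b)) :
    (l ++ [c] ++ r).IsChain (fun a b => a ≠ b) := by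
  have h1 : (l ++ [c]).IsChain (fun a b => a ≠ b) :=
    h.prefix ⟨[s, c] ++ r, by simp⟩
  have h2 : ([c] ++ r).IsChain (fun a b => a ≠ b) :=
    h.suffix ⟨l ++ [c, s], by simp⟩
  exact h1.append_overlap h2 (by simp)

/-- The sequence obtained by applying a cap. -/
def ColorSeq.removeTurn (x : ColorSeq S) {l r : List S} {c s : S}
    (h : x.colors = l ++ [c, s, c] ++ r) : ColorSeq S where
  colors := l ++ [c] ++ r
  ne_nil := by simp
  chain := (h ▸ x.chain).remove_turn

namespace STL

theorem ofDiagram_comp {x y z : ColorSeq S} (p : TLDiagram x y) (p' : TLDiagram y z) :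
    ofDiagram δ (p.comp p') = ofDiagram δ p ≫ ofDiagram δ p' := by
  unfold ofDiagram
  rw [FreeTL.ofDiagram_comp]
  exact Functor.map_comp _ _ _

theorem ofDiagram_nil (x : ColorSeq S) :
    ofDiagram δ (Quiver.Path.nil : TLDiagram x x) = 𝟙 _ :=
  CategoryTheory.Functor.map_id (Quotient.functor (FreeTL.rel δ)) _

theorem ofDiagram_cons {x y z : ColorSeq S} (p : TLDiagram x y) (g : TLGen y z) :
    ofDiagram δ (p.cons g) = ofDiagram δ p ≫ ofDiagram δ g.one :=
  ofDiagram_comp δ p g.one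

theorem ofDiagram_rel {x y : ColorSeq S} {p p' : TLDiagram x y} {c : k} (h : TLRel δ p c p') :
    ofDiagram δ p = c • ofDiagram δ p' := by
  refine (Quotient.functor_map_eq_iff (FreeTL.rel δ) (FreeTL.ofDiagram k p)
    (c • FreeTL.ofDiagram k p')).mpr ?_
  refine Submodule.subset_span ⟨x, y, p, p', c, 𝟙 _, 𝟙 _, h, ?_⟩
  rw [Category.id_comp, Category.comp_id]

theorem mem_span_ofDiagram {x y : ColorSeq S} (f : obj δ x ⟶ obj δ y) :
    f ∈ Submodule.span k (Set.range (ofDiagram δ (x := x) (y := y))) := by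
  obtain ⟨f, rfl⟩ := (Quotient.functor (FreeTL.rel δ)).map_surjective f
  induction FreeTL.mem_span_ofDiagram f using Submodule.span_induction with
  | zero => exact Submodule.zero_mem _
  | add f g _ _ hf hg => exact Submodule.add_mem _ hf hg
  | smul r f _ hf => exact Submodule.smul_mem _ r hf
  | mem f hf =>
    obtain ⟨p, rfl⟩ := hf
    exact Submodule.subset_span ⟨p, rfl⟩

theorem ofDiagram_interchange {x y y' z : ColorSeq S} (g : TLGen x y) (h : TLGen y z)
    (h' : TLGen x y') (g' : TLGen y' z)
    (hg : g'.kind = g.kind ∧ g'.outer = g.outer ∧ g'.inner = g.inner ∧ g'.left = g.left)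
    (hh : h'.kind = h.kind ∧ h'.outer = h.outer ∧ h'.inner = h.inner ∧ h'.right = h.right)
    (disjoint : g.left.length + (g.kind.src g.outer g.inner).length ≤ h'.left.length + 1) :
    ofDiagram δ (g.one.comp h.one) = ofDiagram δ (h'.one.comp g'.one) :=
  (ofDiagram_rel δ (TLRel.interchange g h h' g' hg.1 hg.2.1 hg.2.2.1 hh.1 hh.2.1 hh.2.2.1
    hg.2.2.2 hh.2.2.2 disjoint)).trans (one_smul _ _)

/-- A cup followed by a cap is a cap followed by a cup, or a multiple of the identity. -/
theorem cup_comp_cap {x y z : ColorSeq S} (g : TLGen x y) (h : TLGen y z) (hg : g.kind = .cup)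
    (hh : h.kind = .cap) :
    (∃ (m : ColorSeq S) (h' : TLGen x m) (g' : TLGen m z), h'.kind = .cap ∧ g'.kind = .cup ∧
      ofDiagram δ g.one ≫ ofDiagram δ h.one = ofDiagram δ h'.one ≫ ofDiagram δ g'.one) ∨
    ∃ (e : x = z) (c : k),
      ofDiagram δ g.one ≫ ofDiagram δ h.one = c • eqToHom (congrArg (obj δ) e) := by
  obtain ⟨κ, b, r, u, w, hx, hy⟩ := g
  obtain ⟨κ', c, s, u', w', hy', hz⟩ := h
  obtain rfl : κ = .cup := hg
  obtain rfl : κ' = .cap := hh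
  simp only [TLKind.src, TLKind.tgt] at hx hy hy' hz
  have heq := hy.symm.trans hy'
  simp only [← ofDiagram_comp]
  rw [List.append_assoc, List.append_assoc, List.append_eq_append_iff] at heq
  -- `v` is the offset between the turns `b r b` and `c s c` in the middle sequence. Offset 0 gives
  -- a circle, offset 1 a zigzag, and from offset 2 on interchange applies.
  rcases heq with ⟨v, rfl, hv⟩ | ⟨v, rfl, hv⟩
  · rcases v with _ | ⟨a, _ | ⟨a', v⟩⟩
    · simp only [List.cons_append, List.nil_append, List.cons.injEq] at hv
      obtain ⟨rfl, rfl, -, rfl⟩ := hv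
      obtain rfl : x = z := ColorSeq.ext_colors (by rw [hx, hz]; simp)
      refine .inr ⟨rfl, -δ, ?_⟩
      rw [ofDiagram_rel δ (TLRel.circle u w b r _ _ ⟨rfl, rfl, rfl, rfl, rfl⟩
        ⟨rfl, rfl, rfl, by simp, rfl⟩), ofDiagram_nil, eqToHom_refl]
    · simp only [List.cons_append, List.nil_append, List.cons.injEq] at hv
      obtain ⟨rfl, rfl, rfl, rfl⟩ := hv
      obtain rfl : x = z := ColorSeq.ext_colors (by rw [hx, hz]; simp)
      refine .inr ⟨rfl, 1, ?_⟩
      rw [ofDiagram_rel δ (TLRel.zigzag_left u w' b r _ _ ⟨rfl, rfl, rfl, rfl, rfl⟩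
        ⟨rfl, rfl, rfl, rfl, rfl⟩), ofDiagram_nil, eqToHom_refl]
    · simp only [List.cons_append, List.nil_append, List.cons.injEq] at hv
      obtain ⟨rfl, rfl, hv⟩ := hv
      have hx' : x.colors = u ++ v ++ [c, s, c] ++ w' := by
        rw [hx]; simp [hv]
      -- At offset exactly 2 the remaining `v` is empty and the two turns share the color `b = c`.
      obtain ⟨w'', hw''⟩ : ∃ w'', v ++ c :: w' = b :: w'' := by
        rcases v with _ | ⟨a, v⟩
        · simp only [List.nil_append, List.cons.injEq] at hv
          exact ⟨w', by simp [hv.1]⟩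
        · simp only [List.cons_append, List.cons.injEq] at hv
          exact ⟨v ++ c :: w', by simp [hv.1]⟩
      refine .inl ⟨x.removeTurn hx', ⟨.cap, c, s, u ++ v, w', hx', rfl⟩,
        ⟨.cup, b, r, u, w'', ?_, ?_⟩, rfl, rfl, ?_⟩
      · simp [ColorSeq.removeTurn, TLKind.src, hw'']
      · rw [hz]; simp [TLKind.tgt, hw'']
      · refine ofDiagram_interchange δ _ _ _ _ ⟨rfl, rfl, rfl, rfl⟩ ⟨rfl, rfl, rfl, rfl⟩ ?_
        simp [TLKind.src]
  · rcases v with _ | ⟨a, _ | ⟨a', v⟩⟩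
    · simp only [List.cons_append, List.nil_append, List.cons.injEq] at hv
      obtain ⟨rfl, rfl, -, rfl⟩ := hv
      obtain rfl : x = z := ColorSeq.ext_colors (by rw [hx, hz]; simp)
      refine .inr ⟨rfl, -δ, ?_⟩
      rw [ofDiagram_rel δ (TLRel.circle u' w' c s _ _ ⟨rfl, rfl, rfl, by simp, rfl⟩
        ⟨rfl, rfl, rfl, rfl, rfl⟩), ofDiagram_nil, eqToHom_refl]
    · simp only [List.cons_append, List.nil_append, List.cons.injEq] at hv
      obtain ⟨rfl, rfl, rfl, rfl⟩ := hv
      obtain rfl : x = z := ColorSeq.ext_colors (by rw [hx, hz]; simp)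
      refine .inr ⟨rfl, 1, ?_⟩
      rw [ofDiagram_rel δ (TLRel.zigzag_right u' w c s _ _ ⟨rfl, rfl, rfl, rfl, rfl⟩
        ⟨rfl, rfl, rfl, rfl, rfl⟩), ofDiagram_nil, eqToHom_refl]
    · simp only [List.cons_append, List.nil_append, List.cons.injEq] at hv
      obtain ⟨rfl, rfl, hv⟩ := hv
      obtain ⟨w'', hw''⟩ : ∃ w'', v ++ b :: w = c :: w'' := by
        rcases v with _ | ⟨a, v⟩
        · simp only [List.nil_append, List.cons.injEq] at hv
          exact ⟨w, by simp [hv.1]⟩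
        · simp only [List.cons_append, List.cons.injEq] at hv
          exact ⟨v ++ b :: w, by simp [hv.1]⟩
      have hx' : x.colors = u' ++ [c, s, c] ++ w'' := by
        rw [hx]; simp [hw'']
      refine .inl ⟨x.removeTurn hx', ⟨.cap, c, s, u', w'', hx', rfl⟩,
        ⟨.cup, b, r, u' ++ v, w, ?_, ?_⟩, rfl, rfl, ?_⟩
      · simp [ColorSeq.removeTurn, TLKind.src, hw'']
      · rw [hz]; simp [TLKind.tgt, hv]
      · symm
        refine ofDiagram_interchange δ _ _ _ _ ⟨rfl, rfl, rfl, rfl⟩ ⟨rfl, rfl, rfl, rfl⟩ ?_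
        simp [TLKind.src]

/-- The span of the crossingless matchings. -/
noncomputable def matchingSpan (x y : ColorSeq S) : Submodule k (obj δ x ⟶ obj δ y) :=
  Submodule.span k {f | ∃ (z : ColorSeq S) (T : TLDiagram x z) (U : TLDiagram z y),
    TLDiagram.AllOfKind .cap T ∧ TLDiagram.AllOfKind .cup U ∧
    f = ofDiagram δ T ≫ ofDiagram δ U}

variable {δ}

theorem matchingSpan_comp_cup {x y z : ColorSeq S} {f : obj δ x ⟶ obj δ y}
    (hf : f ∈ matchingSpan δ x y) (g : TLGen y z) (hg : g.kind = .cup) :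
    f ≫ ofDiagram δ g.one ∈ matchingSpan δ x z := by
  induction hf using Submodule.span_induction with
  | zero => rw [zero_comp]; exact Submodule.zero_mem _
  | add f f' _ _ h h' => rw [Preadditive.add_comp]; exact Submodule.add_mem _ h h'
  | smul r f _ h => rw [Linear.smul_comp]; exact Submodule.smul_mem _ _ h
  | mem f hf =>
    obtain ⟨m, T, U, hT, hU, rfl⟩ := hf
    exact Submodule.subset_span ⟨m, T, U.cons g, hT, .cons U g hU hg, by
      rw [ofDiagram_cons, Category.assoc]⟩

theorem TLDiagram_allOfKind_comp {κ : TLKind} {x y z : ColorSeq S} {p : TLDiagram x y}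
    {p' : TLDiagram y z} (hp : p.AllOfKind κ) (hp' : p'.AllOfKind κ) :
    TLDiagram.AllOfKind κ (p.comp p') := by
  induction hp' with
  | nil => exact hp
  | cons p' g _ hg ih => exact .cons _ g ih hg

theorem comp_matchingSpan {x y z : ColorSeq S} (T : TLDiagram x y) (hT : T.AllOfKind .cap)
    {f : obj δ y ⟶ obj δ z} (hf : f ∈ matchingSpan δ y z) :
    ofDiagram δ T ≫ f ∈ matchingSpan δ x z := by
  induction hf using Submodule.span_induction with
  | zero => rw [comp_zero]; exact Submodule.zero_mem _
  | add f f' _ _ h h' => rw [Preadditive.comp_add]; exact Submodule.add_mem _ h h'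
  | smul r f _ h => rw [Linear.comp_smul]; exact Submodule.smul_mem _ _ h
  | mem f hf =>
    obtain ⟨m, T', U, hT', hU, rfl⟩ := hf
    exact Submodule.subset_span ⟨m, T.comp T', U, TLDiagram_allOfKind_comp hT hT', hU, by
      rw [ofDiagram_comp, Category.assoc]⟩

/-- The cap moves down past the cups until it either cancels against one of them or reaches the
bottom. -/
theorem cups_comp_cap {x y z : ColorSeq S} (U : TLDiagram x y) (hU : U.AllOfKind .cup)
    (h : TLGen y z) (hh : h.kind = .cap) :
    ofDiagram δ U ≫ ofDiagram δ h.one ∈ matchingSpan δ x z := by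
  induction hU generalizing z with
  | nil =>
    exact Submodule.subset_span ⟨z, h.one, .nil, .cons _ h .nil hh, .nil, by
      rw [ofDiagram_nil, ofDiagram_nil, Category.id_comp, Category.comp_id]⟩
  | cons U g hU hg ih =>
    rw [ofDiagram_cons, Category.assoc]
    rcases cup_comp_cap δ g h hg hh with ⟨m, h', g', hh', hg', e⟩ | ⟨rfl, c, e⟩
    · rw [e, ← Category.assoc]
      exact matchingSpan_comp_cup (ih h' hh') g' hg'
    · rw [e, eqToHom_refl, Linear.comp_smul, Category.comp_id]
      exact Submodule.smul_mem _ _ (Submodule.subset_span ⟨_, .nil, U, .nil, hU, by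
        rw [ofDiagram_nil, Category.id_comp]⟩)

/-- The crossingless matchings span all morphisms. -/
theorem mem_matchingSpan {x y : ColorSeq S} (f : obj δ x ⟶ obj δ y) : f ∈ matchingSpan δ x y := by
  suffices h : ∀ p : TLDiagram x y, ofDiagram δ p ∈ matchingSpan δ x y by
    refine Submodule.span_le.mpr ?_ (mem_span_ofDiagram δ f)
    rintro _ ⟨p, rfl⟩
    exact h p
  intro p
  clear f
  induction p with
  | nil => exact Submodule.subset_span ⟨_, .nil, .nil, .nil, .nil, by
      rw [ofDiagram_nil, Category.id_comp]⟩
  | cons p g ih =>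
    rw [ofDiagram_cons]
    cases hg : TLGen.kind g with
    | cup => exact matchingSpan_comp_cup ih g hg
    | cap =>
      generalize ofDiagram δ p = f at ih
      induction ih using Submodule.span_induction with
      | zero => rw [zero_comp]; exact Submodule.zero_mem _
      | add f f' _ _ h h' => rw [Preadditive.add_comp]; exact Submodule.add_mem _ h h'
      | smul r f _ h => rw [Linear.smul_comp]; exact Submodule.smul_mem _ _ h
      | mem f hf =>
        obtain ⟨m, T, U, hT, hU, rfl⟩ := hf
        rw [Category.assoc]
        exact comp_matchingSpan T hT (cups_comp_cap U hU g hg)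

end STL

end NormalForm

/-! ### Finiteness of Hom modules and the ideal of shorter sequences -/

section Finiteness

variable {S : Type u}

theorem ColorSeq.finite_length_le [Finite S] (n : ℕ) : {x : ColorSeq S | x.length ≤ n}.Finite :=
  Set.Finite.of_finite_image ((List.finite_length_le S n).subset (by
    rintro _ ⟨x, hx, rfl⟩; exact hx)) fun _ _ _ _ h => ColorSeq.ext_colors h

instance TLKind.finite : Finite TLKind :=
  Finite.of_injective (fun κ : TLKind => match κ with | .cap => true | .cup => false) (by
    rintro (_ | _) (_ | _) h <;> first | rfl | simp at h)

theorem TLGen.finite [Finite S] (x y : ColorSeq S) : Finite (TLGen x y) := by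
  have : Finite {l : List S // l.length ≤ x.colors.length} :=
    (List.finite_length_le S x.colors.length).to_subtype
  refine Finite.of_injective (fun g : TLGen x y => (g.kind, g.outer, g.inner,
    (⟨g.left, by have := g.length_src_add; omega⟩ : {l : List S // l.length ≤ x.colors.length}),
    (⟨g.right, by have := g.length_src_add; omega⟩ :
      {l : List S // l.length ≤ x.colors.length}))) ?_
  rintro ⟨⟩ ⟨⟩ h
  simp only [Prod.mk.injEq, Subtype.mk.injEq] at h
  obtain ⟨rfl, rfl, rfl, rfl, rfl⟩ := h
  rfl

theorem TLDiagram.finite_length_eq [Finite S] (x y : ColorSeq S) (n : ℕ) :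
    {p : TLDiagram x y | p.length = n}.Finite := by
  induction n generalizing y with
  | zero =>
    refine Set.Subsingleton.finite fun p hp p' hp' => ?_
    obtain rfl := Quiver.Path.eq_of_length_zero p hp
    cases p with
    | cons p g => simp at hp
    | nil =>
      cases p' with
      | nil => rfl
      | cons p g => simp at hp'
  | succ n ih =>
    have (z : ColorSeq S) : Finite (TLGen z y) := TLGen.finite z y
    have h : (⋃ z ∈ {z : ColorSeq S | z.length ≤ y.length + 2},
        (fun pg : TLDiagram x z × TLGen z y => (pg.1.cons pg.2 : TLDiagram x y)) ''
          ({p : TLDiagram x z | p.length = n} ×ˢ Set.univ)).Finite :=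
      (ColorSeq.finite_length_le _).biUnion fun z _ => ((ih z).prod Set.finite_univ).image _
    refine h.subset fun p hp => ?_
    cases p with
    | nil => simp at hp
    | cons p g =>
      refine Set.mem_biUnion (x := _) ?_ ⟨(p, g), ⟨?_, trivial⟩, rfl⟩
      · have h1 := TLGen.length_src_add g
        have h2 := TLGen.length_tgt_add g
        have : TLKind.width (TLGen.kind g) ≤ 2 := by cases TLGen.kind g <;> simp [TLKind.width]
        simp only [ColorSeq.length, Set.mem_ofPred_eq]
        omega
      · simpa using hp

theorem TLDiagram.finite_length_le [Finite S] (x y : ColorSeq S) (n : ℕ) :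
    {p : TLDiagram x y | p.length ≤ n}.Finite := by
  refine ((Set.finite_Iic n).biUnion fun m _ => TLDiagram.finite_length_eq x y m).subset
    fun p hp => ?_
  exact Set.mem_biUnion hp rfl

namespace STL

variable {k : Type v} [CommRing k] {δ : k}

/-- In a normal form the middle sequence is no longer than `x`, and the numbers of caps and cups are
bounded by the lengths of `x` and `y`. With finitely many colors only finitely many such diagrams
exist. -/
instance finite_hom [Finite S] (x y : ColorSeq S) : Module.Finite k (obj δ x ⟶ obj δ y) := by
  have h : (⋃ z ∈ {z : ColorSeq S | z.length ≤ x.length},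
      (fun TU : TLDiagram x z × TLDiagram z y => ofDiagram δ TU.1 ≫ ofDiagram δ TU.2) ''
        ({T : TLDiagram x z | T.length ≤ x.length} ×ˢ
          {U : TLDiagram z y | U.length ≤ y.length})).Finite :=
    (ColorSeq.finite_length_le _).biUnion fun z _ =>
      ((TLDiagram.finite_length_le _ _ _).prod (TLDiagram.finite_length_le _ _ _)).image _
  have : Module.Finite k (matchingSpan δ x y) := by
    refine Module.Finite.span_of_finite k (h.subset ?_)
    rintro _ ⟨z, T, U, hT, hU, rfl⟩
    have h1 := hT.length_eq
    have h2 := hU.length_eq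
    simp only [TLKind.coWidth, TLKind.width] at h1 h2
    refine Set.mem_biUnion (x := z) ?_ ⟨(T, U), ⟨?_, ?_⟩, rfl⟩ <;>
      simp only [Set.mem_ofPred_eq] <;> omega
  have htop : matchingSpan δ x y = ⊤ := eq_top_iff.mpr fun f _ => mem_matchingSpan f
  rw [htop] at this
  exact Module.Finite.of_surjective (Submodule.subtype ⊤) fun f => ⟨⟨f, trivial⟩, rfl⟩

instance finite_end [Finite S] (x : ColorSeq S) : Module.Finite k (End (obj δ x)) :=
  finite_hom x x

/-- Morphisms that factor through a sequence which is shorter, or different of the same length,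
lie in the lower ideal. -/
theorem comp_mem_lowerIdeal {x y : ColorSeq S} (hne : y ≠ x) (hle : y.length ≤ x.length)
    (f : obj δ x ⟶ obj δ y) (g : obj δ y ⟶ obj δ x) :
    (f ≫ g : End (obj δ x)) ∈ lowerIdeal δ x := by
  have hf := mem_matchingSpan f
  induction hf using Submodule.span_induction with
  | zero => rw [zero_comp]; exact Submodule.zero_mem _
  | add f f' _ _ h h' => rw [Preadditive.add_comp]; exact Submodule.add_mem _ h h'
  | smul r f _ h => rw [Linear.smul_comp]; exact Submodule.smul_mem _ _ h
  | mem f hf =>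
    obtain ⟨z, T, U, hT, hU, rfl⟩ := hf
    -- Without caps `U` would lead from `x` to `y` by cups alone; as `y` is not longer than `x`,
    -- this forces `y = x`.
    have hT0 : T.length ≠ 0 := by
      intro h0
      obtain rfl := Quiver.Path.eq_of_length_zero T h0
      have h2 := hU.length_eq
      simp only [TLKind.coWidth, TLKind.width] at h2
      exact hne (Quiver.Path.eq_of_length_zero U (by omega)).symm
    rw [Category.assoc]
    -- The rest of the composite is put in normal form again, with the caps of `T` kept at the
    -- bottom.
    generalize ofDiagram δ U ≫ g = g'
    have hg := mem_matchingSpan g'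
    induction hg using Submodule.span_induction with
    | zero => rw [comp_zero]; exact Submodule.zero_mem _
    | add f f' _ _ h h' => rw [Preadditive.comp_add]; exact Submodule.add_mem _ h h'
    | smul r f _ h => rw [Linear.comp_smul]; exact Submodule.smul_mem _ _ h
    | mem f hf =>
      obtain ⟨z', T', U', hT', hU', rfl⟩ := hf
      refine Submodule.subset_span ⟨z', T.comp T', U', TLDiagram_allOfKind_comp hT hT', hU', ?_, ?_⟩
      · rw [Quiver.Path.length_comp]; omega
      · rw [ofDiagram_comp, Category.assoc]

/-- Elements of the lower ideal are sums of morphisms factoring through shorter sequences. -/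
theorem lowerIdeal_induction {x : ColorSeq S} {P : End (obj δ x) → Prop} (zero : P 0)
    (add : ∀ f g, P f → P g → P (f + g))
    (comp : ∀ (z : ColorSeq S) (_ : z.length < x.length) (f : obj δ x ⟶ obj δ z)
      (g : obj δ z ⟶ obj δ x), P (f ≫ g : obj δ x ⟶ obj δ x))
    {f : End (obj δ x)} (hf : f ∈ lowerIdeal δ x) : P f := by
  -- `P` is closed under sums only, so scalars are carried along and absorbed into the first factor.
  suffices h : ∀ r : k, P (r • f) by simpa using h 1
  induction hf using Submodule.span_induction with
  | zero => intro r; rwa [smul_zero]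
  | add f g _ _ hf hg => intro r; rw [smul_add]; exact add _ _ (hf r) (hg r)
  | smul r f _ h => intro s; rw [← mul_smul]; exact h _
  | mem f hf =>
    obtain ⟨z, T, U, hT, hU, h0, rfl⟩ := hf
    intro r
    have h1 := hT.length_eq
    simp only [TLKind.coWidth, TLKind.width] at h1
    have := comp z (by omega) (r • ofDiagram δ T) (ofDiagram δ U)
    rwa [Linear.smul_comp] at this

theorem lowerIdeal_mul {x : ColorSeq S} {f : End (obj δ x)} (hf : f ∈ lowerIdeal δ x)
    (g : End (obj δ x)) : f * g ∈ lowerIdeal δ x ∧ g * f ∈ lowerIdeal δ x := by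
  refine lowerIdeal_induction (P := fun f => f * g ∈ lowerIdeal δ x ∧ g * f ∈ lowerIdeal δ x)
    ?_ ?_ ?_ hf
  · simp
  · intro f f' h h'
    rw [add_mul, mul_add]
    exact ⟨Submodule.add_mem _ h.1 h'.1, Submodule.add_mem _ h.2 h'.2⟩
  · intro z hz f f'
    have hne : z ≠ x := by rintro rfl; exact lt_irrefl _ hz
    constructor
    · have := comp_mem_lowerIdeal hne hz.le ((g : obj δ x ⟶ obj δ x) ≫ f) f'
      rwa [Category.assoc] at this
    · have := comp_mem_lowerIdeal hne hz.le f (f' ≫ (g : obj δ x ⟶ obj δ x))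
      rwa [← Category.assoc] at this

end STL

end Finiteness

/-! ### Krull–Schmidt arguments in preadditive categories -/

section KrullSchmidt

variable {D : Type*} [Category* D] [Preadditive D]

/-- The sums of morphisms factoring through an object of the class `P`. -/
def sumThrough (P : Set D) (X Y : D) : AddSubmonoid (X ⟶ Y) :=
  AddSubmonoid.closure {f | ∃ V ∈ P, ∃ (a : X ⟶ V) (b : V ⟶ Y), f = a ≫ b}

theorem comp_mem_sumThrough {P : Set D} {X V Y : D} (hV : V ∈ P) (a : X ⟶ V) (b : V ⟶ Y) :
    a ≫ b ∈ sumThrough P X Y :=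
  AddSubmonoid.subset_closure ⟨V, hV, a, b, rfl⟩

theorem sumThrough_mono {P Q : Set D} (h : P ⊆ Q) (X Y : D) : sumThrough P X Y ≤ sumThrough Q X Y :=
  AddSubmonoid.closure_mono fun _ ⟨V, hV, a, b, e⟩ => ⟨V, h hV, a, b, e⟩

theorem comp_comp_mem_sumThrough {P : Set D} {X X' Y Y' : D} (a : X' ⟶ X) {f : X ⟶ Y} (b : Y ⟶ Y')
    (hf : f ∈ sumThrough P X Y) : a ≫ f ≫ b ∈ sumThrough P X' Y' := by
  induction hf using AddSubmonoid.closure_induction with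
  | zero => rw [zero_comp, comp_zero]; exact AddSubmonoid.zero_mem _
  | add f g _ _ hf hg =>
    rw [Preadditive.add_comp, Preadditive.comp_add]; exact AddSubmonoid.add_mem _ hf hg
  | mem f hf =>
    obtain ⟨V, hV, c, d, rfl⟩ := hf
    simpa using comp_mem_sumThrough hV (a ≫ c) (d ≫ b)

theorem comp_mem_sumThrough_of_id {P : Set D} {X Y Z : D} (hY : 𝟙 Y ∈ sumThrough P Y Y)
    (a : X ⟶ Y) (b : Y ⟶ Z) : a ≫ b ∈ sumThrough P X Z := by
  simpa using comp_comp_mem_sumThrough a b hY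

/-- Every endomorphism `f` is invertible, or `𝟙 - f` is. -/
def HasLocalEnd (V : D) : Prop :=
  ∀ f : V ⟶ V, (∃ g, f ≫ g = 𝟙 V) ∨ ∃ g, g ≫ (𝟙 V - f) = 𝟙 V

/-- If the identity of a non-zero object is a sum of morphisms factoring through objects with local
endomorphism rings, then one of these is a direct summand. -/
theorem exists_retract_of_mem_sumThrough {P : Set D} (hP : ∀ V ∈ P, HasLocalEnd V) {W : D}
    (hW : ¬ IsZero W) (h : 𝟙 W ∈ sumThrough P W W) :
    ∃ V ∈ P, ∃ (i : V ⟶ W) (r : W ⟶ V), i ≫ r = 𝟙 V := by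
  obtain ⟨l, hl, hs⟩ := AddSubmonoid.exists_list_of_mem_closure h
  induction hn : l.length generalizing l with
  | zero =>
    obtain rfl := List.length_eq_zero_iff.mp hn
    exact (hW ((IsZero.iff_id_eq_zero W).mpr hs.symm)).elim
  | succ n ih =>
    rcases l with _ | ⟨f, l⟩
    · simp at hn
    obtain ⟨V, hV, a, b, rfl⟩ := hl f (by simp)
    rcases hP V hV (b ≫ a) with ⟨g, hg⟩ | ⟨g, hg⟩
    · exact ⟨V, hV, b, a ≫ g, by rw [← Category.assoc, hg]⟩
    · rw [List.sum_cons] at hs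
      -- A left inverse `g` of `𝟙 - b ≫ a` yields the left inverse `𝟙 + a ≫ g ≫ b` of `𝟙 - a ≫ b`,
      -- which is the sum of the remaining terms. Composing with it gives a shorter expression of `𝟙
      -- W`.
      have hinv : (𝟙 W + a ≫ g ≫ b) ≫ l.sum = 𝟙 W := by
        rw [← eq_sub_iff_add_eq'] at hs
        have : a ≫ (g ≫ (𝟙 V - b ≫ a)) ≫ b = a ≫ b := by rw [hg, Category.id_comp]
        rw [hs]
        simp only [Preadditive.add_comp, Preadditive.comp_sub, Preadditive.sub_comp,
          Category.id_comp, Category.comp_id, Category.assoc] at this ⊢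
        rw [sub_eq_iff_eq_add.mp this]
        abel
      refine ih (l.map fun f => (𝟙 W + a ≫ g ≫ b) ≫ f) ?_ ?_ (by simpa using hn)
      · intro _ h'
        obtain ⟨f, hf, rfl⟩ := List.mem_map.mp h'
        obtain ⟨V', hV', a', b', rfl⟩ := hl f (List.mem_cons_of_mem _ hf)
        exact ⟨V', hV', (𝟙 W + a ≫ g ≫ b) ≫ a', b', (Category.assoc _ _ _).symm⟩
      · exact (map_list_sum (Preadditive.leftComp W (𝟙 W + a ≫ g ≫ b)) l).symm.trans hinv

/-- The complementary idempotent `𝟙 - r ≫ i` splits, so `V` is a direct summand of `W`; its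
complement must vanish. -/
theorem CategoryTheory.Indecomposable.nonempty_iso_of_retract [HasBinaryBiproducts D] [IsIdempotentComplete D]
    {W V : D} (hW : Indecomposable W) (hV : ¬ IsZero V) (i : V ⟶ W) (r : W ⟶ V)
    (h : i ≫ r = 𝟙 V) : Nonempty (W ≅ V) := by
  obtain ⟨Z, j, s, hjs, hsj⟩ := IsIdempotentComplete.idempotents_split W (𝟙 W - r ≫ i) (by
    simp only [Preadditive.comp_sub, Preadditive.sub_comp, Category.id_comp, Category.comp_id,
      Category.assoc, reassoc_of% h]
    abel)
  have his : i ≫ s = 0 := by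
    have : i ≫ (s ≫ j) ≫ s = 0 := by
      rw [hsj]; simp [Preadditive.comp_sub, Preadditive.sub_comp, reassoc_of% h]
    simpa [hjs] using this
  have hjr : j ≫ r = 0 := by
    have : j ≫ (s ≫ j) ≫ r = 0 := by
      rw [hsj]; simp [Preadditive.sub_comp, h]
    simpa [reassoc_of% hjs] using this
  have e : W ≅ V ⊞ Z :=
    { hom := biprod.lift r s
      inv := biprod.desc i j
      hom_inv_id := by rw [biprod.lift_desc, hsj]; abel
      inv_hom_id := by ext <;> simp [h, his, hjr, hjs] }
  have hZ := (hW.2 V Z e).resolve_left hV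
  refine ⟨⟨r, i, ?_, h⟩⟩
  rw [hZ.eq_of_tgt s 0, zero_comp] at hsj
  exact (sub_eq_zero.mp hsj.symm).symm

theorem CategoryTheory.Indecomposable.nonempty_iso_of_mem_sumThrough [HasBinaryBiproducts D]
    [IsIdempotentComplete D] {P : Set D} (hP : ∀ V ∈ P, HasLocalEnd V ∧ ¬ IsZero V) {W : D}
    (hW : Indecomposable W) (h : 𝟙 W ∈ sumThrough P W W) : ∃ V ∈ P, Nonempty (W ≅ V) := by
  obtain ⟨V, hV, i, r, hir⟩ := exists_retract_of_mem_sumThrough (fun V hV => (hP V hV).1) hW.1 h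
  exact ⟨V, hV, hW.nonempty_iso_of_retract (hP V hV).2 i r hir⟩

theorem nonempty_iso_biprod_biproduct [HasBinaryBiproducts D] [HasFiniteBiproducts D] {X V : D}
    {m : ℕ} {W : Fin m → D} (i₀ : V ⟶ X) (r₀ : X ⟶ V) (i : ∀ j, W j ⟶ X) (r : ∀ j, X ⟶ W j)
    (h₀ : i₀ ≫ r₀ = 𝟙 V) (h₁ : ∀ j, i₀ ≫ r j = 0) (h₂ : ∀ j, i j ≫ r₀ = 0)
    (h₃ : ∀ j, i j ≫ r j = 𝟙 _) (h₄ : ∀ j l, j ≠ l → i j ≫ r l = 0)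
    (htotal : r₀ ≫ i₀ + ∑ j, r j ≫ i j = 𝟙 X) : Nonempty (X ≅ V ⊞ ⨁ W) := by
  refine ⟨{ hom := biprod.lift r₀ (biproduct.lift r)
            inv := biprod.desc i₀ (biproduct.desc i)
            hom_inv_id := by rw [biprod.lift_desc, biproduct.lift_desc, htotal]
            inv_hom_id := ?_ }⟩
  ext j l
  · simp [h₀]
  · simp [h₁]
  · simp [h₂]
  · by_cases hjl : j = l
    · subst hjl; simp [h₃]
    · simp [h₄ _ _ hjl, biproduct.ι_π_ne _ hjl]

section Split

variable {C : Type*} [Category* C] [Preadditive C] (F : C ⥤ D) [F.Additive] [F.Faithful]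
  {X : C} {e : End X} {V : D} {i : V ⟶ F.obj X} {r : F.obj X ⟶ V}


theorem not_isZero_of_split (hri : r ≫ i = F.map e) (he : e ≠ 0) :
    ¬ IsZero V := by
  intro hV
  refine he (F.map_injective ?_)
  rw [← hri, F.map_zero, hV.eq_of_tgt r 0, zero_comp]

/-- Since `F` is fully faithful, `End V` is the corner of `End X` at `e`, up to the order of
multiplication. A decomposition of `V` therefore gives orthogonal idempotents with sum `e`. -/
theorem CategoryTheory.Indecomposable.of_split [F.Full] [HasBinaryBiproducts D] (hir : i ≫ r = 𝟙 V)
    (hri : r ≫ i = F.map e) (he : IsIndecomposableIdempotent e) : Indecomposable V := by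
  refine ⟨not_isZero_of_split F hri he.2.1, fun Y Z φ => ?_⟩
  -- an endomorphism of `V` as an endomorphism of `X`
  let Θ (p : V ⟶ V) : End X := F.preimage (r ≫ p ≫ i)
  have hΘ (p : V ⟶ V) : F.map (Θ p) = r ≫ p ≫ i := F.map_preimage _
  have hmul (p q : V ⟶ V) : Θ p * Θ q = Θ (q ≫ p) := F.map_injective (by
    rw [End.mul_def, F.map_comp, hΘ, hΘ, hΘ]; simp [reassoc_of% hir])
  have hadd (p q : V ⟶ V) : Θ p + Θ q = Θ (p + q) := F.map_injective (by
    rw [F.map_add, hΘ, hΘ, hΘ]; simp [Preadditive.comp_add, Preadditive.add_comp])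
  have hzero : Θ 0 = 0 := F.map_injective (by rw [hΘ]; simp)
  have hone : Θ (𝟙 V) = e := F.map_injective (by rw [hΘ]; simp [hri])
  have hinj {p : V ⟶ V} (h : Θ p = 0) : p = 0 := by
    have h1 := hΘ p
    rw [h, F.map_zero] at h1
    calc p = i ≫ (r ≫ p ≫ i) ≫ r := by simp [reassoc_of% hir, hir]
      _ = 0 := by rw [← h1]; simp
  have hsum : φ.hom ≫ biprod.fst ≫ biprod.inl ≫ φ.inv + φ.hom ≫ biprod.snd ≫ biprod.inr ≫ φ.inv =
      𝟙 V := by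
    rw [← cancel_epi φ.inv, ← cancel_mono φ.hom]
    simp [Preadditive.comp_add, Preadditive.add_comp]
  rcases he.2.2 (Θ (φ.hom ≫ biprod.fst ≫ biprod.inl ≫ φ.inv))
    (Θ (φ.hom ≫ biprod.snd ≫ biprod.inr ≫ φ.inv))
    (by rw [IsIdempotentElem, hmul]; simp) (by rw [IsIdempotentElem, hmul]; simp)
    (by rw [hmul]; simp [hzero]) (by rw [hmul]; simp [hzero]) (by rw [hadd, hsum, hone]) with h | h
  · left
    have := congrArg (fun f => biprod.inl ≫ φ.inv ≫ f ≫ φ.hom ≫ biprod.fst) (hinj h)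
    rw [IsZero.iff_id_eq_zero]
    simpa using this
  · right
    have := congrArg (fun f => biprod.inr ≫ φ.inv ≫ f ≫ φ.hom ≫ biprod.snd) (hinj h)
    rw [IsZero.iff_id_eq_zero]
    simpa using this

theorem HasLocalEnd.of_split [F.Full] {k : Type*} [CommRing k] [IsLocalRing k]
    [IsAdicComplete (IsLocalRing.maximalIdeal k) k] [Linear k C] [Algebra.IsIntegral k (End X)]
    (hir : i ≫ r = 𝟙 V) (hri : r ≫ i = F.map e) (he : IsIndecomposableIdempotent e) :
    HasLocalEnd V := by
  intro f
  obtain ⟨a, ha⟩ : ∃ a : End X, F.map a = r ≫ f ≫ i := ⟨_, F.map_preimage _⟩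
  have hea : e * a = a := F.map_injective (by
    rw [End.mul_def, F.map_comp, ha, ← hri]; simp [reassoc_of% hir])
  have hae : a * e = a := F.map_injective (by
    rw [End.mul_def, F.map_comp, ha, ← hri]; simp [reassoc_of% hir])
  have hid : i ≫ F.map e ≫ r = 𝟙 V := by rw [← hri]; simp [hir]
  rcases he.exists_inverse (k := k) hea hae with ⟨b, -, hb⟩ | ⟨b, hb, -⟩
  · left
    refine ⟨i ≫ F.map b ≫ r, ?_⟩
    calc f ≫ i ≫ F.map b ≫ r = i ≫ (r ≫ f ≫ i) ≫ F.map b ≫ r := by simp [reassoc_of% hir]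
      _ = i ≫ F.map e ≫ r := by
        rw [← ha, ← hb, End.mul_def, F.map_comp, Category.assoc]
      _ = 𝟙 V := hid
  · right
    refine ⟨i ≫ F.map b ≫ r, ?_⟩
    calc (i ≫ F.map b ≫ r) ≫ (𝟙 V - f)
        = i ≫ F.map b ≫ (r ≫ i - r ≫ f ≫ i) ≫ r := by
          simp [Preadditive.comp_sub, Preadditive.sub_comp, hir]
      _ = i ≫ F.map e ≫ r := by
        rw [← ha, hri, ← F.map_sub, ← Category.assoc (F.map b), ← F.map_comp]
        exact congrArg (fun t => i ≫ F.map t ≫ r) hb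
      _ = 𝟙 V := hid

end Split

end KrullSchmidt

/-! ### Existence of the top idempotent -/

section Decompositions

variable {S : Type u} {k : Type v} [CommRing k] {δ : k}

/-- Orthogonality gives `e i * (e top - 1) = -e i`, and the second factor lies in the ideal. -/
theorem TopDecomposition.mem_lowerIdeal {x : ColorSeq S} (d : TopDecomposition δ x) {i : Fin d.n}
    (hi : i ≠ d.top) : d.e i ∈ STL.lowerIdeal δ x := by
  have h := (STL.lowerIdeal_mul d.top_mod (d.e i)).2
  rw [mul_sub, d.complete.ortho hi, mul_one, zero_sub] at h
  exact neg_mem_iff.mp h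

variable [IsLocalRing k]

/-- Modulo the lower ideal every endomorphism is a scalar `c`, and over the local ring `k` one of
`c`, `1 - c` is a unit. -/
theorem STL.mem_lowerIdeal_or_of_isIdempotentElem {x : ColorSeq S} {e : End (STL.obj δ x)}
    (he : IsIdempotentElem e) : e ∈ lowerIdeal δ x ∨ e - 1 ∈ lowerIdeal δ x := by
  obtain ⟨c, hc⟩ : ∃ c : k, e - c • 1 ∈ lowerIdeal δ x := by
    clear he
    induction mem_matchingSpan e using Submodule.span_induction with
    | zero => exact ⟨0, by simp⟩
    | add f g _ _ hf hg =>
      obtain ⟨c, hc⟩ := hf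
      obtain ⟨d, hd⟩ := hg
      refine ⟨c + d, ?_⟩
      have := Submodule.add_mem _ hc hd
      rwa [sub_add_sub_comm, ← add_smul] at this
    | smul r f _ hf =>
      obtain ⟨c, hc⟩ := hf
      refine ⟨r * c, ?_⟩
      have := Submodule.smul_mem _ r hc
      rwa [smul_sub, ← mul_smul] at this
    | mem f hf =>
      obtain ⟨z, T, U, hT, hU, rfl⟩ := hf
      by_cases h0 : T.length = 0
      · obtain rfl := Quiver.Path.eq_of_length_zero T h0
        have h2 := hU.length_eq
        simp only [TLKind.coWidth, TLKind.width] at h2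
        cases T with
        | cons => simp at h0
        | nil =>
          cases U with
          | cons => simp at h2
          | nil =>
            refine ⟨1, ?_⟩
            rw [ofDiagram_nil, Category.comp_id, one_smul]
            exact (sub_self (1 : End (obj δ x))).symm ▸ Submodule.zero_mem _
      · exact ⟨0, by
          rw [zero_smul, sub_zero]
          exact Submodule.subset_span ⟨z, T, U, hT, hU, h0, rfl⟩⟩
  -- `c` is idempotent modulo the lower ideal
  have hcc : (c * (1 - c)) • (1 : End (obj δ x)) ∈ lowerIdeal δ x := by
    have h1 := Submodule.sub_mem _ (lowerIdeal_mul hc (e + c • 1)).1 hc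
    have h2 : (e - c • 1) * (e + c • 1) - (e - c • 1) = (c * (1 - c)) • (1 : End (obj δ x)) := by
      simp only [mul_add, sub_mul, he.eq, smul_mul_assoc, mul_smul_comm, one_mul, mul_one]
      module
    rwa [h2] at h1
  rcases IsLocalRing.isUnit_or_isUnit_one_sub_self c with hu | hu
  · right
    obtain ⟨u, hu⟩ := hu.exists_left_inv
    have h := Submodule.sub_mem _ hc (Submodule.smul_mem _ u hcc)
    rw [← mul_smul, ← mul_assoc, hu, one_mul, sub_smul, one_smul, sub_sub, add_sub_cancel] at h
    exact h
  · left
    obtain ⟨u, hu⟩ := hu.exists_right_inv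
    have h := Submodule.add_mem _ hc (Submodule.smul_mem _ u hcc)
    rw [← mul_smul, mul_comm u, mul_assoc, hu, mul_one, sub_add_cancel] at h
    exact h

theorem TopDecomposition.nonempty [Finite S] (x : ColorSeq S) :
    Nonempty (TopDecomposition δ x) := by
  obtain ⟨n, e, he, hind, hsum⟩ :=
    (IsIdempotentElem.one (M := End (STL.obj δ x))).exists_decomposition (k := k)
  by_cases h : ∀ i, e i ∈ STL.lowerIdeal δ x
  · exact (STL.one_notMem_lowerIdeal δ x (hsum ▸ Submodule.sum_mem _ fun i _ => h i)).elim
  · push Not at h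
    obtain ⟨i, hi⟩ := h
    exact ⟨⟨n, e, ⟨he, hsum⟩, hind, i,
      (STL.mem_lowerIdeal_or_of_isIdempotentElem (he.idem i)).resolve_left hi⟩⟩

end Decompositions

/-! ### Images of idempotents in the Karoubi envelope -/

namespace KarSTL

variable {S : Type u} {k : Type v} [CommRing k] {δ : k}

/-- The embedding of the category of sequences into its Karoubi envelope. -/
noncomputable abbrev embedding (S : Type u) (δ : k) : STL S δ ⥤ KarSTL S δ :=
  Mat_.embedding (STL S δ) ⋙ toKaroubi (Mat_ (STL S δ))

section image

variable {x : ColorSeq S} {e : End (STL.obj δ x)} (he : IsIdempotentElem e)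

/-- The inclusion of the image of an idempotent. -/
noncomputable def imageι : image δ x e he ⟶ (embedding S δ).obj (STL.obj δ x) :=
  (image δ x e he).decompId_i

/-- The projection to the image of an idempotent. -/
noncomputable def imageπ : (embedding S δ).obj (STL.obj δ x) ⟶ image δ x e he :=
  (image δ x e he).decompId_p

theorem imageι_imageπ : imageι he ≫ imageπ he = 𝟙 _ :=
  (image δ x e he).decompId.symm

theorem imageπ_imageι : imageπ he ≫ imageι he = (embedding S δ).map e :=
  (image δ x e he).decomp_p.symm

end image

/-- The identity of any object is a sum of morphisms factoring through sequences. -/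
theorem id_mem_sumThrough_range (W : KarSTL S δ) :
    𝟙 W ∈ sumThrough (Set.range fun x => (embedding S δ).obj (STL.obj δ x)) W W := by
  have hX : 𝟙 ((toKaroubi (Mat_ (STL S δ))).obj W.X) ∈
      sumThrough (Set.range fun x => (embedding S δ).obj (STL.obj δ x)) _ _ := by
    let φ := Mat_.isoBiproductEmbedding W.X
    have h : 𝟙 W.X = ∑ i, (φ.hom ≫ biproduct.π _ i) ≫
        (biproduct.ι (fun i => (Mat_.embedding (STL S δ)).obj (W.X.X i)) i ≫ φ.inv) := by
      have := congrArg (fun f => φ.hom ≫ f ≫ φ.inv)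
        (biproduct.total (f := fun i => (Mat_.embedding (STL S δ)).obj (W.X.X i)))
      simp only [Preadditive.sum_comp, Preadditive.comp_sum, Category.id_comp,
        Iso.hom_inv_id, Category.assoc] at this
      simp only [Category.assoc]
      exact this.symm
    rw [← CategoryTheory.Functor.map_id, h, Functor.map_sum]
    refine AddSubmonoid.sum_mem _ fun i _ => ?_
    rw [Functor.map_comp]
    have hV : (embedding S δ).obj (W.X.X i) ∈
      Set.range fun x => (embedding S δ).obj (STL.obj δ x) := ⟨(W.X.X i).as, rfl⟩
    exact comp_mem_sumThrough hV _ _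
  rw [W.decompId]
  exact comp_mem_sumThrough_of_id hX _ _

end KarSTL

namespace KarSTL

variable {S : Type u} {k : Type v} [CommRing k] {δ : k} {x : ColorSeq S}

theorem indecomposable_image {e : End (STL.obj δ x)} (he : IsIndecomposableIdempotent e) :
    Indecomposable (image δ x e he.1) :=
  CategoryTheory.Indecomposable.of_split (embedding S δ) (imageι_imageπ he.1) (imageπ_imageι he.1)
    he

theorem hasLocalEnd_image [Finite S] [IsLocalRing k]
    [IsAdicComplete (IsLocalRing.maximalIdeal k) k] {e : End (STL.obj δ x)}
    (he : IsIndecomposableIdempotent e) : HasLocalEnd (image δ x e he.1) :=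
  HasLocalEnd.of_split (embedding S δ) (k := k) (imageι_imageπ he.1) (imageπ_imageι he.1) he

theorem imageι_imageπ_eq_zero {e e' : End (STL.obj δ x)} (he : IsIdempotentElem e)
    (he' : IsIdempotentElem e') (h : e' * e = 0) : imageι he ≫ imageπ he' = 0 := by
  calc imageι he ≫ imageπ he'
      = imageι he ≫ (imageπ he ≫ imageι he) ≫ (imageπ he' ≫ imageι he') ≫ imageπ he' := by
        simp [imageι_imageπ, reassoc_of% imageι_imageπ he]
    _ = imageι he ≫ (embedding S δ).map (e ≫ e') ≫ imageπ he' := by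
        rw [imageπ_imageι, imageπ_imageι, Functor.map_comp, Category.assoc]
    _ = 0 := by
        rw [End.mul_def] at h
        rw [h, Functor.map_zero, zero_comp, comp_zero]

end KarSTL

/-! ### The objects `V_x`: generation, distinctness, uniqueness, decomposition of `x` -/

section Main

open KarSTL

variable {S : Type u} {k : Type v} [CommRing k] {δ : k}

namespace TopDecomposition

variable {x : ColorSeq S} (d : TopDecomposition δ x)

/-- The inclusion of `V_x`. -/
noncomputable def ι : d.V ⟶ (embedding S δ).obj (STL.obj δ x) :=
  imageι (d.complete.idem d.top)

/-- The projection to `V_x`. -/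
noncomputable def π : (embedding S δ).obj (STL.obj δ x) ⟶ d.V :=
  imageπ (d.complete.idem d.top)

theorem ι_π : d.ι ≫ d.π = 𝟙 d.V :=
  imageι_imageπ _

theorem π_ι : d.π ≫ d.ι = (embedding S δ).map (d.e d.top) :=
  imageπ_imageι _

end TopDecomposition

/-- The objects `V_y` for the sequences `y` of length less than `n`. -/
def topObjectsBelow (d : ∀ x : ColorSeq S, TopDecomposition δ x) (n : ℕ) : Set (KarSTL S δ) :=
  {V | ∃ y : ColorSeq S, y.length < n ∧ V = (d y).V}

theorem topObjectsBelow_mono (d : ∀ x : ColorSeq S, TopDecomposition δ x) {m n : ℕ} (h : m ≤ n) :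
    topObjectsBelow d m ⊆ topObjectsBelow d n :=
  fun _ ⟨y, hy, e⟩ => ⟨y, hy.trans_le h, e⟩

theorem id_mem_sumThrough_of_lowerIdeal (d : ∀ x : ColorSeq S, TopDecomposition δ x)
    (x : ColorSeq S) (h : ∀ f ∈ STL.lowerIdeal δ x, (embedding S δ).map f ∈
      sumThrough (topObjectsBelow d x.length) _ _) :
    𝟙 ((embedding S δ).obj (STL.obj δ x)) ∈
      sumThrough (topObjectsBelow d (x.length + 1)) _ _ := by
  have hsum : 𝟙 (STL.obj δ x) = ∑ i, (d x).e i := (d x).complete.complete.symm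
  rw [← CategoryTheory.Functor.map_id, hsum, Functor.map_sum]
  refine AddSubmonoid.sum_mem _ fun i _ => ?_
  by_cases hi : i = (d x).top
  · subst hi
    have hV : (d x).V ∈ topObjectsBelow d (x.length + 1) := ⟨x, Nat.lt_succ_self _, rfl⟩
    rw [← (d x).π_ι]
    exact comp_mem_sumThrough hV _ _
  · exact sumThrough_mono (topObjectsBelow_mono d (Nat.le_succ _)) _ _
      (h _ ((d x).mem_lowerIdeal hi))

/-- Strong induction on length: an element of the ideal is a sum of morphisms through shorter
sequences `z`, and by induction the identity of `z` is a sum of morphisms through objects `V_y` with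
`ℓ(y) ≤ ℓ(z)`. -/
theorem map_mem_sumThrough_of_mem_lowerIdeal (d : ∀ x : ColorSeq S, TopDecomposition δ x)
    (x : ColorSeq S) (f : End (STL.obj δ x)) (hf : f ∈ STL.lowerIdeal δ x) :
    (embedding S δ).map f ∈ sumThrough (topObjectsBelow d x.length) _ _ := by
  induction hn : x.length using Nat.strong_induction_on generalizing x with
  | _ n ih =>
  subst hn
  refine STL.lowerIdeal_induction (P := fun f => (embedding S δ).map f ∈
    sumThrough (topObjectsBelow d x.length) _ _) ?_ ?_ ?_ hf
  · rw [Functor.map_zero]; exact AddSubmonoid.zero_mem _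
  · intro f g hf hg
    rw [Functor.map_add]; exact AddSubmonoid.add_mem _ hf hg
  · intro z hz f g
    rw [Functor.map_comp]
    refine comp_mem_sumThrough_of_id (sumThrough_mono (topObjectsBelow_mono d hz) _ _
      (id_mem_sumThrough_of_lowerIdeal d z fun f hf => ih _ hz z f hf rfl)) _ _

theorem id_mem_sumThrough_topObjects (d : ∀ x : ColorSeq S, TopDecomposition δ x)
    (W : KarSTL S δ) : 𝟙 W ∈ sumThrough (Set.range fun x => (d x).V) W W := by
  refine AddSubmonoid.closure_le.mpr ?_ (id_mem_sumThrough_range W)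
  rintro _ ⟨_, ⟨x, rfl⟩, a, b, rfl⟩
  refine comp_mem_sumThrough_of_id (sumThrough_mono ?_ _ _ (id_mem_sumThrough_of_lowerIdeal d x
    (map_mem_sumThrough_of_mem_lowerIdeal d x))) a b
  rintro _ ⟨y, -, rfl⟩
  exact ⟨y, rfl⟩

theorem TopDecomposition.indecomposable_V {x : ColorSeq S} (d : TopDecomposition δ x) :
    Indecomposable d.V :=
  indecomposable_image (d.indecomposable d.top)

variable [IsLocalRing k]

theorem TopDecomposition.top_notMem {x : ColorSeq S} (d : TopDecomposition δ x) :
    d.e d.top ∉ STL.lowerIdeal δ x := fun h =>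
  STL.one_notMem_lowerIdeal δ x (by simpa using Submodule.sub_mem _ h d.top_mod)

/-- Otherwise the isomorphism factors the top idempotent of `x` through `y`, which puts it in the
lower ideal. -/
theorem TopDecomposition.eq_of_iso_of_length_le {x y : ColorSeq S} (d : TopDecomposition δ x)
    (d' : TopDecomposition δ y) (φ : d.V ≅ d'.V) (hle : y.length ≤ x.length) : x = y := by
  by_contra hne
  obtain ⟨a, ha⟩ := (embedding S δ).map_surjective (d.π ≫ φ.hom ≫ d'.ι)
  obtain ⟨b, hb⟩ := (embedding S δ).map_surjective (d'.π ≫ φ.inv ≫ d.ι)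
  have h : a ≫ b = d.e d.top := (embedding S δ).map_injective (by
    rw [Functor.map_comp, ha, hb, ← d.π_ι]
    simp only [Category.assoc, reassoc_of% d'.ι_π, Iso.hom_inv_id_assoc])
  exact d.top_notMem (h ▸ STL.comp_mem_lowerIdeal (Ne.symm hne) hle a b)

variable [Finite S] [IsAdicComplete (IsLocalRing.maximalIdeal k) k]

theorem TopDecomposition.hasLocalEnd_V {x : ColorSeq S} (d : TopDecomposition δ x) :
    HasLocalEnd d.V :=
  hasLocalEnd_image (d.indecomposable d.top)

theorem TopDecomposition.nonempty_iso {x : ColorSeq S} (d d' : TopDecomposition δ x) :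
    Nonempty (d.V ≅ d'.V) := by
  rcases d.hasLocalEnd_V (d.ι ≫ d'.π ≫ d'.ι ≫ d.π) with ⟨g, hg⟩ | ⟨g, hg⟩
  · obtain ⟨φ⟩ := d'.indecomposable_V.nonempty_iso_of_retract d.indecomposable_V.1 (d.ι ≫ d'.π)
      (d'.ι ≫ d.π ≫ g) (by simpa using hg)
    exact ⟨φ.symm⟩
  · exfalso
    obtain ⟨a, ha⟩ : ∃ a : End (STL.obj δ x), (embedding S δ).map a = d.π ≫ g ≫ d.ι :=
      (embedding S δ).map_surjective _
    -- If `𝟙` minus the composite `V → V' → V` is invertible on one side, then `e_top` is a multiple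
    -- of `1 - e'_top`, an element of the ideal.
    have h : d.e d.top = d.e d.top * (1 - d'.e d'.top) * a := (embedding S δ).map_injective (by
      have h1 : (embedding S δ).map (1 - d'.e d'.top : End (STL.obj δ x)) =
          𝟙 _ - d'.π ≫ d'.ι := by
        rw [d'.π_ι, ← CategoryTheory.Functor.map_id]
        exact Functor.map_sub _
      rw [End.mul_def, End.mul_def, Functor.map_comp, Functor.map_comp, ha, h1, ← d.π_ι]
      have h2 := congrArg (fun f => d.π ≫ f ≫ d.ι) hg
      simp only [Preadditive.comp_sub, Preadditive.sub_comp, Category.assoc, Category.comp_id,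
        Category.id_comp] at h2 ⊢
      exact h2.symm.trans (by rw [reassoc_of% d.ι_π]))
    refine d.top_notMem (h ▸ (STL.lowerIdeal_mul (STL.lowerIdeal_mul ?_ _).2 a).1)
    rw [← neg_mem_iff, neg_sub]
    exact d'.top_mod

theorem exists_iso_biprod (d : ∀ x : ColorSeq S, TopDecomposition δ x) (x : ColorSeq S) :
    ∃ (n : ℕ) (y : Fin n → ColorSeq S), (∀ i, (y i).length < x.length) ∧
      Nonempty (KarSTL.obj δ x ≅ (d x).V ⊞ ⨁ fun i => (d (y i)).V) := by
  have he := (d x).complete.idem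
  -- A non-top idempotent lies in the lower ideal, so the identity of its image is a sum of
  -- morphisms through objects `V_y` with `ℓ(y) < ℓ(x)`; being indecomposable, the image is one of
  -- these.
  have key (i : {i // i ≠ (d x).top}) : ∃ y : ColorSeq S, y.length < x.length ∧
      Nonempty (image δ x ((d x).e i) (he i) ≅ (d y).V) := by
    obtain ⟨_, ⟨y, hy, rfl⟩, hiso⟩ :=
      (indecomposable_image ((d x).indecomposable i)).nonempty_iso_of_mem_sumThrough
        (P := topObjectsBelow d x.length) (by
          rintro _ ⟨y, -, rfl⟩
          exact ⟨(d y).hasLocalEnd_V, (d y).indecomposable_V.1⟩) (by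
          have h := comp_comp_mem_sumThrough (imageι (he i)) (imageπ (he i))
            (map_mem_sumThrough_of_mem_lowerIdeal d x _ ((d x).mem_lowerIdeal i.2))
          rw [← imageπ_imageι (he i)] at h
          simpa [imageι_imageπ, reassoc_of% imageι_imageπ (he i)] using h)
    exact ⟨y, hy, hiso⟩
  choose y hy φ using key
  let σ := (Fintype.equivFin {i // i ≠ (d x).top}).symm
  have hne {j l} (h : j ≠ l) : (σ j : Fin (d x).n) ≠ σ l := fun h' =>
    h (σ.injective (Subtype.ext h'))
  have ortho {i j} (h : i ≠ j) : imageι (he i) ≫ imageπ (he j) = 0 :=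
    imageι_imageπ_eq_zero _ _ ((d x).complete.ortho h.symm)
  obtain ⟨ψ⟩ := nonempty_iso_biprod_biproduct (imageι (he (d x).top)) (imageπ (he (d x).top))
    (fun j => imageι (he (σ j))) (fun j => imageπ (he (σ j))) (imageι_imageπ _)
    (fun j => ortho (σ j).2.symm) (fun j => ortho (σ j).2) (fun j => imageι_imageπ _)
    (fun j l h => ortho (hne h)) (by
      have hsum : 𝟙 (STL.obj δ x) = ∑ i, (d x).e i := (d x).complete.complete.symm
      simp only [imageπ_imageι]
      rw [← CategoryTheory.Functor.map_id, hsum, Functor.map_sum,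
        Fintype.sum_eq_add_sum_subtype_ne _ (d x).top]
      congr 1
      exact σ.sum_comp fun i : {i // i ≠ (d x).top} => (embedding S δ).map ((d x).e i))
  exact ⟨_, fun j => y (σ j), fun j => hy (σ j),
    ⟨ψ ≪≫ biprod.mapIso (Iso.refl _) (biproduct.mapIso fun j => (φ (σ j)).some)⟩⟩

end Main

theorem mainTheorem8 {S : Type u} [Finite S] {k : Type v} [CommRing k] [IsLocalRing k]
    [IsAdicComplete (IsLocalRing.maximalIdeal k) k] (δ : k) :
    -- a decomposition as required can be chosen for every sequence
    (∀ x : ColorSeq S, Nonempty (TopDecomposition δ x)) ∧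
    -- for every choice of decompositions:
    (∀ d : ∀ x : ColorSeq S, TopDecomposition δ x,
      -- the objects `V_x` are a complete list of non-isomorphic indecomposable objects
      (∀ x, Indecomposable (d x).V) ∧
      (∀ x y, Nonempty ((d x).V ≅ (d y).V) → x = y) ∧
      (∀ W : KarSTL S δ, Indecomposable W → ∃ x, Nonempty (W ≅ (d x).V)) ∧
      -- `x` is the direct sum of `V_x` and finitely many `V_y` (with repetitions), `ℓ(y) < ℓ(x)`
      (∀ x, ∃ (n : ℕ) (y : Fin n → ColorSeq S), (∀ i, (y i).length < x.length) ∧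
        Nonempty (KarSTL.obj δ x ≅ (d x).V ⊞ ⨁ fun i => (d (y i)).V))) ∧
    -- up to isomorphism, `V_x` does not depend on the decomposition
    (∀ (x : ColorSeq S) (d d' : TopDecomposition δ x), Nonempty (d.V ≅ d'.V)) := by
  refine ⟨TopDecomposition.nonempty, fun d => ⟨fun x => (d x).indecomposable_V, ?_, ?_,
    exists_iso_biprod d⟩, fun x d d' => d.nonempty_iso d'⟩
  · rintro x y ⟨φ⟩
    rcases le_total y.length x.length with h | h
    · exact (d x).eq_of_iso_of_length_le (d y) φ h
    · exact ((d y).eq_of_iso_of_length_le (d x) φ.symm h).symm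
  · intro W hW
    obtain ⟨_, ⟨x, rfl⟩, h⟩ := hW.nonempty_iso_of_mem_sumThrough (by
      rintro _ ⟨x, rfl⟩
      exact ⟨(d x).hasLocalEnd_V, (d x).indecomposable_V.1⟩) (id_mem_sumThrough_topObjects d W)
    exact ⟨x, h⟩
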